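/- Let $S^1=\mathbb{R}/\mathbb{Z}$, with arc length $|\cdot|$ (total length $1$). A \emph{multicritical circle map} is an orientation-preserving homeomorphism $f:S^1\to S^1$ of class $C^r$, $r\ge 3$, with finitely many critical points $c_0,\dots,c_{N-1}$ (all the zeros of $f'$), for which there are neighbourhoods $W_i$ of $c_i$ such that: (1) the Schwarzian derivative $Sf=(f''/f')'-\frac12(f''/f')^2$ is negative on $W_i\setminus\{c_i\}$; (2) there are constants $0<\alpha_i<\beta_i$ and $s_i>1$ with $\alpha_i|x-c_i|^{s_i-1}<f'(x)<\beta_i|x-c_i|^{s_i-1}$ for all $x\in W_i\setminus\{c_i\}$; (3) $\log f'$ has bounded variation on $S^1\setminus\bigcup_i W_i$. Let $f$ be a multicritical circle map without periodic points, and let $\rho=[a_0,a_1,\dots]=1/(a_0+1/(a_1+\cdots))\in(0,1)$ be its (irrational) rotation number. Put $q_0=1$, $q_1=a_0$, and $q_{n+1}=a_nq_n+q_{n-1}$ for $n\ge1$. For $x\in S^1$ and $n\ge 0$, let $I_n(x)$ be the closed arc with endpoints $x$ and $f^{q_n}(x)$ that contains $f^{q_{n+2}}(x)$. Then there is a constant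 $K>1$, depending only on $f$, such that the following holds for every critical point $c_0$ of $f$, every $n\ge0$ and every $0\le k<a_{n+1}$. If the arc $\Delta_k=f^{q_n+kq_{n+1}}(I_{n+1}(c_0))$ (which lies inside $I_n(c_0)$) contains a critical point of $f^{q_{n+1}}$, then $$K^{-1}\,|I_n(c_0)|\;\le\;|\Delta_k|\;\le\;K\,|I_n(c_0)| .$$ -/

import Mathlib

open MeasureTheory Topology

noncomputable section

namespace MulticriticalCircle

/-- The circle `ℝ / ℤ`. -/
abbrev Circle1 : Type := UnitAddCircle

/-- `G : ℝ → ℝ` is a (continuous) lift of `g : ℝ / ℤ → ℝ / ℤ`. -/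
def IsLift (G : ℝ → ℝ) (g : Circle1 → Circle1) : Prop :=
  Continuous G ∧ ∀ x : ℝ, ((G x : ℝ) : Circle1) = g (x : Circle1)

/-- `y` is a critical point of `g : ℝ / ℤ → ℝ / ℤ`: the derivative of `g` at `y`, computed in a
lift, exists and vanishes. -/
def IsCriticalPt (g : Circle1 → Circle1) (y : Circle1) : Prop :=
  ∃ G : ℝ → ℝ, IsLift G g ∧ ∃ x : ℝ, (x : Circle1) = y ∧ HasDerivAt G 0 x

/-- The Schwarzian derivative `SF = (F''/F')' - (1/2) (F''/F')²`. -/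
def schwarzian (F : ℝ → ℝ) (x : ℝ) : ℝ :=
  deriv (fun t => deriv (deriv F) t / deriv F t) x
    - (1 / 2) * (deriv (deriv F) x / deriv F x) ^ 2

/-- Multicritical circle maps.  The homeomorphism `f` preserves orientation: it has a monotone lift
`F` with `F (x + 1) = F x + 1`.  The derivatives of `f` are those of `F` (two lifts differ by an
integer constant). -/
def IsMulticritical (f : Circle1 ≃ₜ Circle1) : Prop :=
  ∃ F : CircleDeg1Lift, IsLift F f ∧ ContDiff ℝ 3 F ∧
    {c : Circle1 | IsCriticalPt f c}.Finite ∧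
    ∃ W : Circle1 → Set Circle1,
      (∀ c : Circle1, IsCriticalPt f c →
        W c ∈ 𝓝 c ∧
        (∀ x : ℝ, (x : Circle1) ∈ W c → (x : Circle1) ≠ c → schwarzian F x < 0) ∧
        ∃ α β s : ℝ, 0 < α ∧ α < β ∧ 1 < s ∧
          ∀ x : ℝ, (x : Circle1) ∈ W c → (x : Circle1) ≠ c →
            α * dist (x : Circle1) c ^ (s - 1) < deriv F x ∧
            deriv F x < β * dist (x : Circle1) c ^ (s - 1)) ∧
      BoundedVariationOn (fun x : ℝ => Real.log (deriv F x))
        {x : ℝ | x ∈ Set.Icc (0 : ℝ) 1 ∧ ∀ c : Circle1, IsCriticalPt f c → (x : Circle1) ∉ W c}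

open Classical in
/-- The rotation number, in `[0, 1)`, of an orientation-preserving homeomorphism of the circle: the
fractional part of the translation number of a lift.  (Junk value `0` if there is no monotone
lift.) -/
def rotationNumber (f : Circle1 ≃ₜ Circle1) : ℝ :=
  if h : ∃ F : CircleDeg1Lift, IsLift F f then
    Int.fract (CircleDeg1Lift.translationNumber h.choose) else 0

/-- The rotation number does not depend on the lift. -/
theorem rotationNumber_eq (f : Circle1 ≃ₜ Circle1) (F : CircleDeg1Lift) (hF : IsLift F f) :
    rotationNumber f = Int.fract (CircleDeg1Lift.translationNumber F) := by
  have h : ∃ F : CircleDeg1Lift, IsLift F f := ⟨F, hF⟩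
  have key : ∀ F G : CircleDeg1Lift, IsLift F f → IsLift G f →
      ∃ k : ℤ, ∀ x, F x = G x + k := by
    intro F G hF hG
    have hint : ∀ x, ∃ k : ℤ, (k : ℝ) = F x - G x := by
      intro x
      have h1 : ((F x : ℝ) : Circle1) = ((G x : ℝ) : Circle1) := (hF.2 x).trans (hG.2 x).symm
      have h2 : ((F x - G x : ℝ) : Circle1) = 0 := by
        rw [AddCircle.coe_sub, h1, sub_self]
      obtain ⟨k, hk⟩ := (AddCircle.coe_eq_zero_iff (1 : ℝ)).1 h2
      exact ⟨k, by simpa using hk⟩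
    choose k hk using hint
    have hc : Continuous k := by
      rw [Int.isClosedEmbedding_coe_real.isInducing.continuous_iff]
      have : ((↑) : ℤ → ℝ) ∘ k = fun x => F x - G x := funext hk
      rw [this]
      exact hF.1.sub hG.1
    refine ⟨k 0, fun x => ?_⟩
    have hx : k x = k 0 := PreconnectedSpace.constant inferInstance hc
    have := hk x
    rw [hx] at this
    linarith
  obtain ⟨k, hk⟩ := key F h.choose hF h.choose_spec
  have hFG : F = (CircleDeg1Lift.translate (Multiplicative.ofAdd (k : ℝ)) : CircleDeg1Lift)
      * h.choose := by
    ext x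
    simp [hk x, add_comm]
  have hτ : CircleDeg1Lift.translationNumber F
      = CircleDeg1Lift.translationNumber h.choose + k := by
    rw [hFG, CircleDeg1Lift.translationNumber_mul_of_commute,
      CircleDeg1Lift.translationNumber_translate, add_comm]
    ext x
    simp
  rw [rotationNumber, dif_pos h, hτ, Int.fract_add_intCast]

/-- The `n`-th partial quotient `a n` in `ρ = 1 / (a 0 + 1 / (a 1 + ⋯))`, for `0 < ρ < 1`. -/
def partialQuotient (ρ : ℝ) (n : ℕ) : ℕ :=
  ⌊((GenContFract.of ρ).partDens.get? n).getD 0⌋₊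

/-- The return times `q 0 = 1`, `q 1 = a 0`, `q (n + 2) = a (n + 1) * q (n + 1) + q n`. -/
def returnTime (ρ : ℝ) : ℕ → ℕ
  | 0 => 1
  | 1 => partialQuotient ρ 0
  | n + 2 => partialQuotient ρ (n + 1) * returnTime ρ (n + 1) + returnTime ρ n

/-- The partial quotients `a n` of the rotation number of `f`. -/
def a (f : Circle1 ≃ₜ Circle1) (n : ℕ) : ℕ := partialQuotient (rotationNumber f) n

/-- The return times `q n` of `f`. -/
def q (f : Circle1 ≃ₜ Circle1) (n : ℕ) : ℕ := returnTime (rotationNumber f) n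

open Classical in
/-- `I f n x` is that one of the two closed arcs with endpoints `x` and `f^{q n} x` which contains
`f^{q (n + 2)} x`.  (`Set.cIcc u v` is the closed arc from `u` counterclockwise to `v`.) -/
def I (f : Circle1 ≃ₜ Circle1) (n : ℕ) (x : Circle1) : Set Circle1 :=
  if f^[q f (n + 2)] x ∈ Set.cIcc x (f^[q f n] x) then Set.cIcc x (f^[q f n] x)
  else Set.cIcc (f^[q f n] x) x

/-- `Δ f n x k = f^{q n + k q (n + 1)} (I_{n + 1} (x))`. -/
def Δ (f : Circle1 ≃ₜ Circle1) (n : ℕ) (x : Circle1) (k : ℕ) : Set Circle1 :=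
  f^[q f n + k * q f (n + 1)] '' I f (n + 1) x

/-- The length of an arc of the circle (the whole circle has length `1`). -/
def arcLength (A : Set Circle1) : ℝ := (volume : Measure Circle1).real A

end MulticriticalCircle

end

namespace MulticriticalCircle

/-! ### Cross-ratios and the Schwarzian derivative -/

/-! The work is done on the line, with a lift `E` of `f`: since the rotation number ρ is irrational,
the points `orb E i m x` are ordered as the numbers `i * ρ + m`, and all combinatorics of closest
returns becomes arithmetic of ρ. The upper bound is the inclusion of Δ_k in I_n. The lower bound is
a real-bounds argument of Yoccoz and Świątek type.

The tool is the cross-ratio (b-a)(d-c)/((c-a)(d-b)). Near a critical point, but off it, negative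
Schwarzian derivative keeps a map from increasing cross-ratios; away from the critical points the
distortion is exp(O(d-a)); an interval containing a critical point costs a bounded factor. The first
q_{n+1} iterates of an interval [x, f^{q_n} x) are disjoint, so the lengths sum to at most 1 and few
iterates contain critical points. Hence iterates up to time 3 q_{n+1} increase cross-ratios by a
bounded factor (`IsTameLift.exists_crossRatio_orb_le`). Consequently, if the middle one of three
adjacent intervals is not long compared with its neighbours at the end, it was not long at the start
(`sub_le_of_crossRatio_le`).

This is used three times. Starting from the point where f^{q_n} moves points least, it shows that
[f^{-q_n} x, x] and [x, f^{q_n} x] are comparable for every x (`IsTameLift.exists_adjacent_le`). At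
a critical point c, let t = |I_{n+1}(c)|/|I_n(c)|. The cross-ratio of suitable points is at most of
order t^s after one step, by the power law, and at least of order t after the full return; as s > 1,
t is bounded below (`IsTameLift.exists_le_at_critical`). Finally, if Δ_k contains a critical point
of f^{q_{n+1}}, some f^i with i < q_{n+1} carries it to a critical point of f, where f^i(Δ_k) is
comparable with the intervals of level n; pulling back by f^i gives the claim
(`IsTameLift.exists_le_of_critical_mem`). Returns from the left are handled by conjugating with x ↦
-x. -/

theorem sub_le_sub_of_hasDerivAt_le {G H G' H' : ℝ → ℝ} {a b : ℝ} (hab : a ≤ b)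
    (hG : ∀ x ∈ Set.Icc a b, HasDerivAt G (G' x) x) (hH : ∀ x ∈ Set.Icc a b, HasDerivAt H (H' x) x)
    (h : ∀ x ∈ Set.Icc a b, G' x ≤ H' x) : G b - G a ≤ H b - H a := by
  have hd : ∀ x ∈ Set.Icc a b, HasDerivAt (fun x => H x - G x) (H' x - G' x) x :=
    fun x hx => (hH x hx).sub (hG x hx)
  have hm : MonotoneOn (fun x => H x - G x) (Set.Icc a b) := by
    refine monotoneOn_of_deriv_nonneg (convex_Icc a b)
      (fun x hx => (hd x hx).continuousAt.continuousWithinAt)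
      (fun x hx => (hd x (interior_subset hx)).differentiableAt.differentiableWithinAt) ?_
    intro x hx
    rw [(hd x (interior_subset hx)).deriv]
    linarith [h x (interior_subset hx)]
  have := hm (Set.left_mem_Icc.2 hab) (Set.right_mem_Icc.2 hab) hab
  simp only at this
  linarith

/-- Möbius maps are the comparison maps: they are the ones whose derivative is the inverse square of
an affine function. This primitive is normalised to vanish at `x₀`. -/
theorem hasDerivAt_mobius {p k x₀ x : ℝ} (h₀ : p + x₀ * k ≠ 0) (h : p + x * k ≠ 0) :
    HasDerivAt (fun x => (x - x₀) / ((p + x₀ * k) * (p + x * k))) (1 / (p + x * k) ^ 2) x := by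
  have h1 : HasDerivAt (fun x : ℝ => x - x₀) 1 x := (hasDerivAt_id x).sub_const x₀
  have h2 : HasDerivAt (fun x : ℝ => (p + x₀ * k) * (p + x * k)) ((p + x₀ * k) * k) x := by
    simpa using (((hasDerivAt_id x).mul_const k).const_add p).const_mul (p + x₀ * k)
  refine (h1.div h2 (mul_ne_zero h₀ h)).congr_deriv ?_
  rw [div_eq_div_iff (pow_ne_zero 2 (mul_ne_zero h₀ h)) (pow_ne_zero 2 h)]
  ring

/-- If `G' = 1 / v²` with `v` convex, then `G` expands the middle one of three points towards the
left less than the Möbius map with the same derivatives at `b` and `c`. -/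
theorem three_point_of_convexOn {G v : ℝ → ℝ} {a b c : ℝ} (hab : a < b) (hbc : b < c)
    (hG : ∀ x ∈ Set.Icc a c, HasDerivAt G (1 / (v x) ^ 2) x) (hv : ConvexOn ℝ (Set.Icc a c) v)
    (hpos : ∀ x ∈ Set.Icc a c, 0 < v x) :
    (G b - G a) * ((c - a) * v b) ≤ (b - a) * v c * (G c - G a) := by
  -- The affine function `p + x * k` interpolates `v` at `b` and `c`. By convexity it lies above `v`
  -- on `[b, c]` and below `v` on `[a, b]`, so `G` is compared in opposite directions with one
  -- Möbius map on the two intervals.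
  obtain ⟨k, hk⟩ : ∃ k, k = (v c - v b) / (c - b) := ⟨_, rfl⟩
  obtain ⟨p, hp⟩ : ∃ p, p = v b - b * k := ⟨_, rfl⟩
  have hcb : 0 < c - b := sub_pos.2 hbc
  have hk' : k * (c - b) = v c - v b := by rw [hk]; field_simp
  have hlb : p + b * k = v b := by rw [hp]; ring
  have hlc : p + c * k = v c := by rw [hp]; linarith
  have ma : a ∈ Set.Icc a c := ⟨le_rfl, by linarith⟩
  have mb : b ∈ Set.Icc a c := ⟨hab.le, hbc.le⟩
  have mc : c ∈ Set.Icc a c := ⟨by linarith, le_rfl⟩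
  have vb := hpos b mb
  have vc := hpos c mc
  have hin : ∀ x ∈ Set.Icc b c, v x ≤ p + x * k := by
    intro x hx
    have h1 := hv.2 mb mc (div_nonneg (by linarith [hx.2]) hcb.le : 0 ≤ (c - x) / (c - b))
      (div_nonneg (by linarith [hx.1]) hcb.le : 0 ≤ (x - b) / (c - b)) (by field_simp; ring)
    simp only [smul_eq_mul] at h1
    have e1 : (c - x) / (c - b) * b + (x - b) / (c - b) * c = x := by field_simp; ring
    have e2 : (c - x) / (c - b) * v b + (x - b) / (c - b) * v c = p + x * k := by
      rw [← hlb, ← hlc]; field_simp; ring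
    rwa [e1, e2] at h1
  have hout : ∀ x ∈ Set.Icc a b, p + x * k ≤ v x := by
    intro x hx
    rcases eq_or_lt_of_le hx.2 with h | h
    · rw [h, hlb]
    have h1 := hv.slope_mono_adjacent ⟨hx.1, by linarith⟩ mc h hbc
    rw [← hk, div_le_iff₀ (by linarith)] at h1
    rw [hp]; linarith
  have hM : (c - b) / (v b * v c) ≤ G c - G b := by
    have := sub_le_sub_of_hasDerivAt_le (G := fun x => (x - b) / ((p + b * k) * (p + x * k)))
      (H := G) (G' := fun x => 1 / (p + x * k) ^ 2) (H' := fun x => 1 / (v x) ^ 2) hbc.le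
      (fun x hx => hasDerivAt_mobius (by rw [hlb]; exact vb.ne')
        ((hpos x ⟨by linarith [hx.1], hx.2⟩).trans_le (hin x hx)).ne')
      (fun x hx => hG x ⟨by linarith [hx.1], hx.2⟩)
      (fun x hx => one_div_le_one_div_of_le (pow_pos (hpos x ⟨by linarith [hx.1], hx.2⟩) 2)
        (pow_le_pow_left₀ (hpos x ⟨by linarith [hx.1], hx.2⟩).le (hin x hx) 2))
    simpa [hlb, hlc] using this
  have hLG : 0 ≤ G b - G a := by
    have := sub_le_sub_of_hasDerivAt_le (G := fun _ => (0 : ℝ))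
      (H := G) (G' := fun x => 0) (H' := fun x => 1 / (v x) ^ 2) hab.le
      (fun x _ => hasDerivAt_const x 0)
      (fun x hx => hG x ⟨hx.1, by linarith [hx.2]⟩) (fun x _ => by positivity)
    simpa using this
  have hM0 : 0 ≤ G c - G b := le_trans (by positivity) hM
  have key : (G b - G a) * ((p + a * k) * (c - b)) ≤ (b - a) * v c * (G c - G b) := by
    have hba : 0 < b - a := sub_pos.2 hab
    -- The affine function may vanish in `[a, b]`, where the Möbius map has a pole; then the left
    -- side is nonpositive and nothing is left to prove.
    rcases le_or_gt (p + a * k) 0 with h | h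
    · refine le_trans (mul_nonpos_of_nonneg_of_nonpos hLG
        (mul_nonpos_of_nonpos_of_nonneg h hcb.le)) (by positivity)
    have hl : ∀ x ∈ Set.Icc a b, 0 < p + x * k := by
      intro x hx
      have : (p + x * k) * (b - a) = (p + a * k) * (b - x) + (p + b * k) * (x - a) := by ring
      have h3 : 0 < (p + a * k) * (b - x) + (p + b * k) * (x - a) := by
        rw [hlb]
        rcases eq_or_lt_of_le hx.1 with h4 | h4
        · rw [← h4]; simp only [sub_self, mul_zero, add_zero]; positivity
        · exact add_pos_of_nonneg_of_pos (mul_nonneg h.le (by linarith [hx.2]))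
            (mul_pos vb (by linarith))
      rw [← this] at h3
      exact pos_of_mul_pos_left h3 hba.le
    have hL : G b - G a ≤ (b - a) / ((p + a * k) * v b) := by
      have := sub_le_sub_of_hasDerivAt_le (H := fun x => (x - a) / ((p + a * k) * (p + x * k)))
        (G := G) (H' := fun x => 1 / (p + x * k) ^ 2) (G' := fun x => 1 / (v x) ^ 2) hab.le
        (fun x hx => hG x ⟨hx.1, by linarith [hx.2]⟩)
        (fun x hx => hasDerivAt_mobius h.ne' (hl x hx).ne')
        (fun x hx => one_div_le_one_div_of_le (pow_pos (hl x hx) 2)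
          (pow_le_pow_left₀ (hl x hx).le (hout x hx) 2))
      simpa [hlb] using this
    calc (G b - G a) * ((p + a * k) * (c - b))
        ≤ (b - a) / ((p + a * k) * v b) * ((p + a * k) * (c - b)) := by gcongr
      _ = (b - a) * v c * ((c - b) / (v b * v c)) := by field_simp
      _ ≤ _ := by gcongr
  have e : (p + a * k) * (c - b) = (c - a) * v b - (b - a) * v c := by
    rw [hp]; linear_combination (a - b) * hk'
  rw [e] at key
  linarith

/-- The cross-ratio of four points. -/
noncomputable def crossRatio (a b c d : ℝ) : ℝ := (b - a) * (d - c) / ((c - a) * (d - b))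

/-- The three-point inequality is applied to `a, b, c` and, after reflection, to `b, c, d`. The
factors `v c / v b` and `v b / v c` cancel in the product. -/
theorem crossRatio_le_of_convexOn {G v : ℝ → ℝ} {a b c d : ℝ} (hab : a < b) (hbc : b < c)
    (hcd : c < d) (hG : ∀ x ∈ Set.Icc a d, HasDerivAt G (1 / (v x) ^ 2) x)
    (hv : ConvexOn ℝ (Set.Icc a d) v) (hpos : ∀ x ∈ Set.Icc a d, 0 < v x) (hmono : StrictMono G) :
    crossRatio (G a) (G b) (G c) (G d) ≤ crossRatio a b c d := by
  have h1 := three_point_of_convexOn hab hbc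
    (fun x hx => hG x ⟨hx.1, by linarith [hx.2]⟩)
    (hv.subset (Set.Icc_subset_Icc_right hcd.le) (convex_Icc _ _))
    (fun x hx => hpos x ⟨hx.1, by linarith [hx.2]⟩)
  have h2 := three_point_of_convexOn (G := fun x => - G (-x)) (v := fun x => v (-x))
    (neg_lt_neg hcd) (neg_lt_neg hbc)
    (fun x hx => by
      have := (hG (-x) ⟨by linarith [hx.2], by linarith [hx.1]⟩)
      exact (this.scomp x (hasDerivAt_neg x)).neg.congr_deriv (by simp))
    (by
      have := hv.comp_linearMap (-LinearMap.id)
      refine (this.subset ?_ (convex_Icc _ _))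
      intro x hx
      simp only [Set.mem_preimage, LinearMap.neg_apply, LinearMap.id_apply, Set.mem_Icc]
      exact ⟨by linarith [hx.2], by linarith [hx.1]⟩)
    (fun x hx => hpos (-x) ⟨by linarith [hx.2], by linarith [hx.1]⟩)
  simp only [neg_neg] at h2
  have vb := hpos b ⟨hab.le, by linarith⟩
  have vc := hpos c ⟨by linarith, hcd.le⟩
  have g1 := sub_pos.2 (hmono hab)
  have g2 := sub_pos.2 (hmono hbc)
  have g3 := sub_pos.2 (hmono hcd)
  have g4 : 0 < G c - G a := by linarith
  have g5 : 0 < G d - G b := by linarith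
  have i1 : 0 < c - a := by linarith
  have i2 : 0 < d - b := by linarith
  have i3 : 0 < b - a := by linarith
  have i4 : 0 < d - c := by linarith
  have k1 : (G b - G a) / (G c - G a) ≤ (b - a) * v c / ((c - a) * v b) := by
    rw [div_le_div_iff₀ g4 (by positivity)]; linarith
  have k2 : (G d - G c) / (G d - G b) ≤ (d - c) * v b / ((d - b) * v c) := by
    rw [div_le_div_iff₀ g5 (by positivity)]; linarith
  calc crossRatio (G a) (G b) (G c) (G d)
      = (G b - G a) / (G c - G a) * ((G d - G c) / (G d - G b)) := by
        unfold crossRatio; rw [mul_div_mul_comm]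
    _ ≤ (b - a) * v c / ((c - a) * v b) * ((d - c) * v b / ((d - b) * v c)) := by
        gcongr
    _ = crossRatio a b c d := by unfold crossRatio; field_simp

/-- A diffeomorphism with negative Schwarzian derivative decreases cross-ratios. -/
theorem crossRatio_le_of_schwarzian_neg {F : ℝ → ℝ} (hF : ContDiff ℝ 3 F) (hmono : StrictMono F)
    {a b c d : ℝ} (hab : a < b) (hbc : b < c) (hcd : c < d)
    (hpos : ∀ x ∈ Set.Icc a d, 0 < deriv F x) (hS : ∀ x ∈ Set.Icc a d, schwarzian F x < 0) :
    crossRatio (F a) (F b) (F c) (F d) ≤ crossRatio a b c d := by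
  have hF1 : ContDiff ℝ 2 (deriv F) := by
    have : ContDiff ℝ (2 + 1) F := hF.of_le (by norm_num)
    exact (contDiff_succ_iff_deriv.1 this).2.2
  have hF2 : ContDiff ℝ 1 (deriv (deriv F)) := by
    have : ContDiff ℝ (1 + 1) (deriv F) := hF1.of_le (by norm_num)
    exact (contDiff_succ_iff_deriv.1 this).2.2
  have d0 : ∀ x, HasDerivAt F (deriv F x) x := fun x =>
    (hF.differentiable (by norm_num) x).hasDerivAt
  have d1 : ∀ x, HasDerivAt (deriv F) (deriv (deriv F) x) x := fun x =>
    (hF1.differentiable (by norm_num) x).hasDerivAt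
  have d2 : ∀ x, HasDerivAt (deriv (deriv F)) (deriv (deriv (deriv F)) x) x := fun x =>
    (hF2.differentiable (by norm_num) x).hasDerivAt
  set N : ℝ → ℝ := fun t => deriv (deriv F) t / deriv F t with hN
  -- With this `v` one has F' = 1 / v² and v'' = -(1/2) · v · SF, so negative Schwarzian derivative
  -- means convexity of `v`.
  set v : ℝ → ℝ := fun x => (deriv F x) ^ (-(1 / 2) : ℝ) with hv
  have dN : ∀ x ∈ Set.Icc a d, HasDerivAt N (deriv N x) x := fun x hx =>
    ((d2 x).div (d1 x) (hpos x hx).ne').differentiableAt.hasDerivAt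
  have dv : ∀ x ∈ Set.Icc a d, HasDerivAt v (-(1 / 2) * (v x * N x)) x := by
    intro x hx
    refine ((d1 x).rpow_const (p := -(1 / 2)) (Or.inl (hpos x hx).ne')).congr_deriv ?_
    rw [hv, hN]
    simp only
    rw [Real.rpow_sub (hpos x hx), Real.rpow_one]
    ring
  have dv' : ∀ x ∈ Set.Icc a d, HasDerivAt (fun x => -(1 / 2) * (v x * N x))
      (-(1 / 2) * (v x * schwarzian F x)) x := by
    intro x hx
    refine (((dv x hx).mul (dN x hx)).const_mul (-(1 / 2))).congr_deriv ?_
    have : schwarzian F x = deriv N x - (1 / 2) * (N x) ^ 2 := rfl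
    rw [this]; ring
  have vpos : ∀ x ∈ Set.Icc a d, 0 < v x := fun x hx => Real.rpow_pos_of_pos (hpos x hx) _
  refine crossRatio_le_of_convexOn (v := v) hab hbc hcd ?_ ?_ vpos hmono
  · intro x hx
    refine (d0 x).congr_deriv ?_
    rw [hv]
    simp only
    rw [← Real.rpow_natCast, ← Real.rpow_mul (hpos x hx).le]
    norm_num
    rw [Real.rpow_neg_one, inv_inv]
  · refine convexOn_of_hasDerivWithinAt2_nonneg (convex_Icc a d)
      (fun x hx => (dv x hx).continuousAt.continuousWithinAt)
      (fun x hx => (dv x (interior_subset hx)).hasDerivWithinAt)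
      (fun x hx => (dv' x (interior_subset hx)).hasDerivWithinAt) ?_
    intro x hx
    have := mul_neg_of_pos_of_neg (vpos x (interior_subset hx)) (hS x (interior_subset hx))
    linarith

/-! ### Power-law critical points -/

theorem exists_sub_eq_mul_of_hasDerivAt {F F' : ℝ → ℝ} (hF : ∀ x, HasDerivAt F (F' x) x) {x y : ℝ}
    (h : x < y) : ∃ ξ, x < ξ ∧ ξ < y ∧ F y - F x = F' ξ * (y - x) := by
  obtain ⟨ξ, hξ, e⟩ := exists_hasDerivAt_eq_slope F F' h
    (fun x _ => (hF x).continuousAt.continuousWithinAt) (fun x _ => hF x)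
  refine ⟨ξ, hξ.1, hξ.2, ?_⟩
  rw [e, div_mul_cancel₀]
  linarith

/-- The derivative `F'` behaves like `|x - z| ^ (s - 1)` on the ball of radius `r` about `z`. -/
def PowerLaw (F' : ℝ → ℝ) (z r α β s : ℝ) : Prop :=
  0 < r ∧ 0 < α ∧ 0 < β ∧ 1 < s ∧ ∀ x, |x - z| < r →
    α * |x - z| ^ (s - 1) ≤ F' x ∧ F' x ≤ β * |x - z| ^ (s - 1)

theorem PowerLaw.reflect {F' : ℝ → ℝ} {z r α β s : ℝ} (h : PowerLaw F' z r α β s) :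
    PowerLaw (fun x => F' (-x)) (-z) r α β s := by
  obtain ⟨h1, h2, h3, h4, h5⟩ := h
  refine ⟨h1, h2, h3, h4, fun x hx => ?_⟩
  have e : |(-x) - z| = |x - (-z)| := by rw [← abs_neg]; congr 1; ring
  have := h5 (-x) (by rwa [e])
  rwa [e] at this

theorem hasDerivAt_reflect {F F' : ℝ → ℝ} (hF : ∀ x, HasDerivAt F (F' x) x) (x : ℝ) :
    HasDerivAt (fun x => -F (-x)) (F' (-x)) x :=
  ((hF (-x)).scomp x (hasDerivAt_neg x)).neg.congr_deriv (by simp)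

theorem strictMono_reflect {F : ℝ → ℝ} (hF : StrictMono F) : StrictMono (fun x => -F (-x)) :=
  fun _ _ h => neg_lt_neg (hF (neg_lt_neg h))

/-- The endpoint `v` is the one farther from `z`, so `F'` is at most `β * (v - z) ^ (s - 1)` on `[u,
v]`. Since v - u ≤ 2(v - z), the last quarter of the interval stays at distance at least (v - z)/2
from `z`, and its image alone is long enough; hence the factors 4 and `2 ^ (s - 1)`. -/
theorem PowerLaw.deriv_mul_le_aux {F F' : ℝ → ℝ} (hF : ∀ x, HasDerivAt F (F' x) x)
    (hmono : StrictMono F) {z r α β s : ℝ} (h : PowerLaw F' z r α β s) {u x v : ℝ}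
    (hv : |v - z| < r) (hux : u ≤ x) (hxv : x ≤ v) (huv : |u - z| ≤ |v - z|) :
    F' x * (v - u) ≤ β / α * 2 ^ (s - 1) * 4 * (F v - F u) := by
  obtain ⟨hr, hα, hβ, hs, h⟩ := h
  rcases eq_or_lt_of_le (hux.trans hxv) with e | huv'
  · simp [e]
  have hvz : |v - z| = v - z := by
    apply abs_of_nonneg
    by_contra hlt
    push Not at hlt
    rw [abs_of_neg hlt, abs_of_neg (by linarith)] at huv
    linarith
  rw [hvz] at huv hv
  have hu' := abs_le.1 huv
  have hD : 0 < v - z := by linarith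
  have hx : |x - z| ≤ v - z := abs_le.2 ⟨by linarith, by linarith⟩
  have hs' : 0 ≤ s - 1 := by linarith
  have b1 : F' x ≤ β * (v - z) ^ (s - 1) := (h x (by linarith)).2.trans (by gcongr)
  obtain ⟨ξ, hξ1, hξ2, hξ⟩ := exists_sub_eq_mul_of_hasDerivAt hF
    (show v - (v - u) / 4 < v by linarith)
  have hξz : (v - z) / 2 ≤ ξ - z := by linarith
  have hξz' : |ξ - z| = ξ - z := abs_of_pos (by linarith)
  have b2 : α * ((v - z) / 2) ^ (s - 1) ≤ F' ξ := by
    refine le_trans ?_ (h ξ (by rw [hξz']; linarith)).1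
    rw [hξz']; gcongr
  have b3 : F (v - (v - u) / 4) ≥ F u := hmono.monotone (by linarith)
  rw [Real.div_rpow hD.le (by norm_num)] at b2
  have hvu : 0 < v - u := by linarith
  calc F' x * (v - u) ≤ β * (v - z) ^ (s - 1) * (v - u) := by gcongr
    _ = β / α * 2 ^ (s - 1) * 4 * (α * ((v - z) ^ (s - 1) / 2 ^ (s - 1)) * ((v - u) / 4)) := by
        field_simp
    _ ≤ β / α * 2 ^ (s - 1) * 4 * (F' ξ * ((v - u) / 4)) := by gcongr
    _ ≤ β / α * 2 ^ (s - 1) * 4 * (F v - F u) := by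
        gcongr
        have : v - (v - (v - u) / 4) = (v - u) / 4 := by ring
        rw [this] at hξ
        linarith

/-- Near a power-law critical point, the derivative at a point of an interval is at most a constant
times the mean derivative on the interval. -/
theorem PowerLaw.deriv_mul_le {F F' : ℝ → ℝ} (hF : ∀ x, HasDerivAt F (F' x) x)
    (hmono : StrictMono F) {z r α β s : ℝ} (h : PowerLaw F' z r α β s) {u x v : ℝ} (hu : |u - z| < r)
    (hv : |v - z| < r) (hux : u ≤ x) (hxv : x ≤ v) :
    F' x * (v - u) ≤ β / α * 2 ^ (s - 1) * 4 * (F v - F u) := by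
  rcases le_total |u - z| |v - z| with h' | h'
  · exact h.deriv_mul_le_aux hF hmono hv hux hxv h'
  · have e : ∀ y : ℝ, |(-y) - (-z)| = |y - z| := fun y => by rw [← abs_neg]; congr 1; ring
    have := h.reflect.deriv_mul_le_aux (hasDerivAt_reflect hF) (strictMono_reflect hmono)
      (u := -v) (x := -x) (v := -u) (by rwa [e]) (neg_le_neg hxv) (neg_le_neg hux)
      (by rwa [e, e])
    simp only [neg_neg] at this
    convert this using 2 <;> ring

/-- Within distance `r` the mean value theorem applies, on the right half of the interval for the
lower bound. Farther away, `F y - F z` lies between its value at `z + r / 2` and 1; this accounts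
for the terms with `r / 2` in the constants. -/
theorem PowerLaw.sub_bounds_right {F F' : ℝ → ℝ} (hF : ∀ x, HasDerivAt F (F' x) x)
    (hmono : StrictMono F) (hper : ∀ x, F (x + 1) = F x + 1) {z r α β s : ℝ}
    (h : PowerLaw F' z r α β s) {y : ℝ} (hy : z < y) (hy1 : y ≤ z + 1) :
    F y - F z ≤ (β + (r / 2) ^ (-s)) * (y - z) ^ s ∧
      min (α * 2 ^ (-s)) (α * 2 ^ (-s) * (r / 2) ^ s) * (y - z) ^ s ≤ F y - F z := by
  obtain ⟨hr, hα, hβ, hs, h⟩ := h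
  have hs' : 0 ≤ s - 1 := by linarith
  have near : ∀ y, z < y → y < z + r →
      F y - F z ≤ β * (y - z) ^ s ∧ α * 2 ^ (-s) * (y - z) ^ s ≤ F y - F z := by
    intro y hy hyr
    have hyz : 0 < y - z := by linarith
    have es : ∀ t : ℝ, 0 < t → t ^ (s - 1) * t = t ^ s := fun t ht => by
      rw [Real.rpow_sub_one ht.ne']; field_simp
    constructor
    · obtain ⟨ξ, h1, h2, e⟩ := exists_sub_eq_mul_of_hasDerivAt hF hy
      have hξ : |ξ - z| = ξ - z := abs_of_pos (by linarith)
      have := (h ξ (by rw [hξ]; linarith)).2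
      rw [hξ] at this
      calc F y - F z = F' ξ * (y - z) := e
        _ ≤ β * (y - z) ^ (s - 1) * (y - z) := by
          gcongr
          refine this.trans ?_
          gcongr
        _ = β * (y - z) ^ s := by rw [mul_assoc, es _ hyz]
    · obtain ⟨ξ, h1, h2, e⟩ := exists_sub_eq_mul_of_hasDerivAt hF (show y - (y - z) / 2 < y by linarith)
      have hξ : |ξ - z| = ξ - z := abs_of_pos (by linarith)
      have := (h ξ (by rw [hξ]; linarith)).1
      rw [hξ] at this
      have e2 : y - (y - (y - z) / 2) = (y - z) / 2 := by ring
      rw [e2] at e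
      have e3 : F z ≤ F (y - (y - z) / 2) := hmono.monotone (by linarith)
      calc α * 2 ^ (-s) * (y - z) ^ s = α * ((y - z) / 2) ^ s := by
            rw [Real.div_rpow hyz.le (by norm_num), Real.rpow_neg (by norm_num)]; field_simp
        _ = α * ((y - z) / 2) ^ (s - 1) * ((y - z) / 2) := by rw [mul_assoc, es _ (by linarith)]
        _ ≤ F' ξ * ((y - z) / 2) := by
          gcongr
          refine le_trans ?_ this
          gcongr
          linarith
        _ ≤ F y - F z := by linarith
  have hyz : 0 < y - z := by linarith
  rcases lt_or_ge y (z + r) with hlt | hge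
  · obtain ⟨h1, h2⟩ := near y hy hlt
    constructor
    · refine h1.trans ?_
      gcongr
      have : 0 < (r / 2) ^ (-s) := by positivity
      linarith
    · refine le_trans ?_ h2
      gcongr
      exact min_le_left _ _
  · have hle : F y - F z ≤ 1 := by
      have := hmono.monotone hy1
      rw [hper] at this; linarith
    constructor
    · have : 1 ≤ (r / 2) ^ (-s) * (y - z) ^ s := by
        rw [Real.rpow_neg (by positivity), inv_mul_eq_div, one_le_div (by positivity)]
        gcongr
        linarith
      have : 0 < β * (y - z) ^ s := by positivity
      linarith
    · have h2 := (near (z + r / 2) (by linarith) (by linarith)).2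
      have e1 : z + r / 2 - z = r / 2 := by ring
      rw [e1] at h2
      have h3 : F (z + r / 2) ≤ F y := hmono.monotone (by linarith)
      have h4 : (y - z) ^ s ≤ 1 := Real.rpow_le_one hyz.le (by linarith) (by linarith)
      calc _ ≤ α * 2 ^ (-s) * (r / 2) ^ s * (y - z) ^ s := by gcongr; exact min_le_right _ _
        _ ≤ α * 2 ^ (-s) * (r / 2) ^ s * 1 := by gcongr
        _ ≤ _ := by linarith

/-- A power-law critical point contracts short one-sided neighbourhoods: if on the two sides of `z`
there are intervals of lengths `z - y` and `w - z` whose ratio is not decreased much, then these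
lengths are comparable. -/
theorem PowerLaw.exists_comparable {F F' : ℝ → ℝ} (hF : ∀ x, HasDerivAt F (F' x) x)
    (hmono : StrictMono F) (hper : ∀ x, F (x + 1) = F x + 1) (r α β s : ℝ)
    {κ : ℝ} (hκ : 0 < κ) :
    ∃ C : ℝ, 0 < C ∧ ∀ z, PowerLaw F' z r α β s → ∀ y w : ℝ, z - 1 ≤ y → y < z → z < w → w ≤ z + 1 →
      κ * (z - y) * (F w - F z) ≤ (F z - F y) * (w - z) → w - z ≤ C * (z - y) := by
  obtain ⟨b, hb⟩ : ∃ b, b = β + (r / 2) ^ (-s) := ⟨_, rfl⟩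
  obtain ⟨a, ha⟩ : ∃ a, a = min (α * 2 ^ (-s)) (α * 2 ^ (-s) * (r / 2) ^ s) := ⟨_, rfl⟩
  refine ⟨max ((b / (κ * a)) ^ (1 / (s - 1))) 1, by positivity, fun z h y w hy1 hy hw hw1 hle => ?_⟩
  have hr := h.1
  have hα := h.2.1
  have hβ := h.2.2.1
  have hs := h.2.2.2.1
  have hb0 : 0 < b := by rw [hb]; positivity
  have ha0 : 0 < a := by rw [ha]; exact lt_min (by positivity) (by positivity)
  have hR := (h.sub_bounds_right hF hmono hper hw hw1).2
  have hL := (h.reflect.sub_bounds_right (hasDerivAt_reflect hF) (strictMono_reflect hmono)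
    (fun x => by
      have := hper (-(x + 1))
      rw [show -(x + 1) + 1 = -x by ring] at this
      linarith) (y := -y) (by linarith) (by linarith)).1
  simp only [neg_neg] at hL
  rw [← ha] at hR
  rw [← hb, show -y - -z = z - y by ring] at hL
  have p : 0 < z - y := by linarith
  have q : 0 < w - z := by linarith
  have es : ∀ t : ℝ, 0 < t → t ^ s = t ^ (s - 1) * t := fun t ht => by
    rw [Real.rpow_sub_one ht.ne']; field_simp
  -- Both lengths enter with exponent `s` on one side and 1 on the other; cancelling leaves a
  -- comparison of powers with exponent `s - 1 > 0`, whose root is taken.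
  have k1 : κ * (z - y) * (a * (w - z) ^ s) ≤ b * (z - y) ^ s * (w - z) := by
    calc _ ≤ κ * (z - y) * (F w - F z) := by gcongr
      _ ≤ (F z - F y) * (w - z) := hle
      _ ≤ _ := by gcongr; linarith
  rw [es _ p, es _ q] at k1
  have k2 : (w - z) ^ (s - 1) ≤ b / (κ * a) * (z - y) ^ (s - 1) := by
    rw [div_mul_eq_mul_div, le_div_iff₀ (by positivity)]
    have : (w - z) ^ (s - 1) * (κ * a) * ((z - y) * (w - z)) ≤
        b * (z - y) ^ (s - 1) * ((z - y) * (w - z)) := by linarith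
    exact le_of_mul_le_mul_right this (by positivity)
  have hs1 : 0 < s - 1 := by linarith
  have k3 := Real.rpow_le_rpow (by positivity) k2 (by positivity : 0 ≤ 1 / (s - 1))
  rw [Real.mul_rpow (by positivity) (by positivity), ← Real.rpow_mul q.le, ← Real.rpow_mul p.le,
    mul_one_div_cancel hs1.ne', Real.rpow_one, Real.rpow_one] at k3
  refine k3.trans ?_
  gcongr
  exact le_max_left _ _

/-! ### Local cross-ratio estimates for lifts -/

theorem coe_eq_coe_iff_exists_int {x y : ℝ} :
    (x : Circle1) = (y : Circle1) ↔ ∃ m : ℤ, x = y + m := by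
  rw [← sub_eq_zero, ← AddCircle.coe_sub, AddCircle.coe_eq_zero_iff]
  refine exists_congr fun m => ?_
  rw [zsmul_one]
  constructor <;> intro h <;> linarith

/-- Critical points of a lift are finite in number only modulo 1. Monotonicity of `P` in the
constant lets the largest of finitely many constants serve all of them. -/
theorem exists_uniform_of_finite {S : Set Circle1} (hS : S.Finite) {P : ℝ → ℝ → Prop}
    (hP : ∀ z C C', C ≤ C' → P z C → P z C')
    (h : ∀ c ∈ S, ∃ C, ∀ z : ℝ, (z : Circle1) = c → P z C) :
    ∃ C, ∀ z : ℝ, (z : Circle1) ∈ S → P z C := by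
  choose! C hC using h
  obtain ⟨B, hB⟩ := (hS.image C).bddAbove
  exact ⟨B, fun z hz => hP z _ _ (hB ⟨_, hz, rfl⟩) (hC _ hz z rfl)⟩

theorem exists_bound_of_periodic {S : Set ℝ} (hS : IsClosed S) {g : ℝ → ℝ}
    (hS1 : ∀ x ∈ S, ∀ m : ℤ, x + m ∈ S) (hg : ContinuousOn g S)
    (hg1 : ∀ x, ∀ m : ℤ, g (x + m) = g x) : ∃ C, 0 < C ∧ ∀ x ∈ S, g x ≤ C := by
  obtain ⟨C, hC⟩ := ((isCompact_Icc (a := (0 : ℝ)) (b := 1)).inter_right hS).exists_bound_of_continuousOn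
    (hg.mono Set.inter_subset_right)
  refine ⟨max C 1, by positivity, fun x hx => ?_⟩
  have e : x + ((-⌊x⌋ : ℤ) : ℝ) = Int.fract x := by
    rw [Int.cast_neg, ← sub_eq_add_neg, Int.self_sub_floor]
  have h1 := hS1 x hx (-⌊x⌋)
  rw [← hg1 x (-⌊x⌋)]
  rw [e] at h1 ⊢
  exact (le_abs_self _).trans ((hC _ ⟨⟨Int.fract_nonneg x, (Int.fract_lt_one x).le⟩, h1⟩).trans
    (le_max_left _ _))

theorem crossRatio_pos {a b c d : ℝ} (hab : a < b) (hbc : b < c) (hcd : c < d) :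
    0 < crossRatio a b c d :=
  div_pos (mul_pos (by linarith) (by linarith)) (mul_pos (by linarith) (by linarith))

/-- The cross-ratio is the product of `(b - a) / (c - a)` and `(d - c) / (d - b)`, and each factor
grows by at most `κ`. -/
theorem crossRatio_le_of_mean {F : ℝ → ℝ} (hmono : StrictMono F) {a b c d κ : ℝ} (hab : a < b)
    (hbc : b < c) (hcd : c < d) (hκ : 0 ≤ κ)
    (h1 : (F b - F a) * (c - a) ≤ κ * (F c - F a) * (b - a))
    (h2 : (F d - F c) * (d - b) ≤ κ * (F d - F b) * (d - c)) :
    crossRatio (F a) (F b) (F c) (F d) ≤ κ * κ * crossRatio a b c d := by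
  have g1 := sub_pos.2 (hmono hab)
  have g2 := sub_pos.2 (hmono hbc)
  have g3 := sub_pos.2 (hmono hcd)
  have g4 : 0 < F c - F a := by linarith
  have g5 : 0 < F d - F b := by linarith
  have i1 : 0 < c - a := by linarith
  have i2 : 0 < d - b := by linarith
  have i3 : 0 < b - a := by linarith
  have i4 : 0 < d - c := by linarith
  have k1 : (F b - F a) / (F c - F a) ≤ κ * (b - a) / (c - a) := by
    rw [div_le_div_iff₀ g4 i1]; linarith
  have k2 : (F d - F c) / (F d - F b) ≤ κ * (d - c) / (d - b) := by
    rw [div_le_div_iff₀ g5 i2]; linarith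
  calc crossRatio (F a) (F b) (F c) (F d)
      = (F b - F a) / (F c - F a) * ((F d - F c) / (F d - F b)) := by
        unfold crossRatio; rw [mul_div_mul_comm]
    _ ≤ κ * (b - a) / (c - a) * (κ * (d - c) / (d - b)) := by
        gcongr
    _ = κ * κ * crossRatio a b c d := by unfold crossRatio; field_simp

/-- A lift of a circle map satisfying, near its critical points, the conditions in the definition of
a multicritical circle map. -/
structure IsTameLift (F : ℝ → ℝ) : Prop where
  contDiff : ContDiff ℝ 3 F
  strictMono : StrictMono F
  map_add_int : ∀ x, ∀ m : ℤ, F (x + m) = F x + m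
  finite : ((fun x : ℝ => (x : Circle1)) '' {x | deriv F x = 0}).Finite
  powerLaw : ∀ z, deriv F z = 0 → ∃ r α β s, ∀ m : ℤ, PowerLaw (deriv F) (z + m) r α β s ∧
    ∀ x, |x - (z + m)| < r → x ≠ z + m → schwarzian F x < 0

namespace IsTameLift

theorem hasDerivAt {F : ℝ → ℝ} (hF : IsTameLift F) (x : ℝ) : HasDerivAt F (deriv F x) x :=
  (hF.contDiff.differentiable (by norm_num) x).hasDerivAt

theorem contDiff_deriv {F : ℝ → ℝ} (hF : IsTameLift F) : ContDiff ℝ 2 (deriv F) := by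
  have : ContDiff ℝ (2 + 1) F := hF.contDiff.of_le (by norm_num)
  exact (contDiff_succ_iff_deriv.1 this).2.2

theorem map_add_one {F : ℝ → ℝ} (hF : IsTameLift F) (x : ℝ) : F (x + 1) = F x + 1 := by
  simpa using hF.map_add_int x 1

theorem deriv_add_int {F : ℝ → ℝ} (hF : IsTameLift F) (x : ℝ) (m : ℤ) : deriv F (x + m) = deriv F x := by
  have : HasDerivAt F (deriv F x) (x + m) := by
    have h := ((hF.hasDerivAt (x + m - m)).comp_sub_const (x + m) (m : ℝ)).add_const (m : ℝ)
    rw [add_sub_cancel_right] at h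
    have e : (fun x => F (x - m) + m) = F := by
      ext y
      rw [← hF.map_add_int, sub_add_cancel]
    rwa [e] at h
  exact this.deriv

theorem deriv_nonneg {F : ℝ → ℝ} (hF : IsTameLift F) (x : ℝ) : 0 ≤ deriv F x := hF.strictMono.monotone.deriv_nonneg

/-- Estimates near critical points, uniform in the critical point. -/
theorem exists_uniform {F : ℝ → ℝ} (hF : IsTameLift F)
    {P : ℝ → ℝ → Prop} (hP : ∀ z C C', C ≤ C' → P z C → P z C')
    (h : ∀ r α β s, 0 < r → ∃ C, ∀ z, deriv F z = 0 → PowerLaw (deriv F) z r α β s →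
      (∀ x, |x - z| < r → x ≠ z → schwarzian F x < 0) → P z C) :
    ∃ C, ∀ z, deriv F z = 0 → P z C := by
  obtain ⟨C, hC⟩ := exists_uniform_of_finite hF.finite hP (by
    rintro c ⟨z, hz, rfl⟩
    obtain ⟨r, α, β, s, h'⟩ := hF.powerLaw z hz
    obtain ⟨C, hC⟩ := h r α β s (h' 0).1.1
    refine ⟨C, fun w hw => ?_⟩
    obtain ⟨m, e⟩ := coe_eq_coe_iff_exists_int.1 hw
    rw [e]
    exact hC _ (by rw [hF.deriv_add_int]; exact hz) (h' m).1 (h' m).2)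
  exact ⟨C, fun z hz => hC z ⟨z, hz, rfl⟩⟩


theorem exists_deriv_le {F : ℝ → ℝ} (hF : IsTameLift F) : ∃ M, 0 < M ∧ ∀ x, deriv F x ≤ M := by
  obtain ⟨M, hM, h⟩ := exists_bound_of_periodic isClosed_univ (fun _ _ _ => trivial)
    hF.contDiff_deriv.continuous.continuousOn hF.deriv_add_int
  exact ⟨M, hM, fun x => h x trivial⟩

theorem exists_deriv_deriv_le {F : ℝ → ℝ} (hF : IsTameLift F) :
    ∃ M, 0 < M ∧ ∀ x, |deriv (deriv F) x| ≤ M := by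
  obtain ⟨M, hM, h⟩ := exists_bound_of_periodic (g := fun x => |deriv (deriv F) x|)
    isClosed_univ (fun _ _ _ => trivial)
    (hF.contDiff_deriv.continuous_deriv (by norm_num)).abs.continuousOn (fun x m => by
      have : (fun x => deriv F (x + m)) = deriv F := funext fun x => hF.deriv_add_int x m
      rw [← deriv_comp_add_const, this])
  exact ⟨M, hM, fun x => h x trivial⟩

theorem exists_le_deriv {F : ℝ → ℝ} (hF : IsTameLift F) {δ : ℝ} (hδ : 0 < δ) :
    ∃ m₀, 0 < m₀ ∧ ∀ x, (∀ z, deriv F z = 0 → δ ≤ |x - z|) → m₀ ≤ deriv F x := by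
  have hc : IsClosed {x : ℝ | ∀ z, deriv F z = 0 → δ ≤ |x - z|} := by
    simp only [Set.ofPred_forall]
    exact isClosed_iInter fun z => isClosed_iInter fun _ =>
      isClosed_le continuous_const (by fun_prop)
  have hpos : ∀ x ∈ {x : ℝ | ∀ z, deriv F z = 0 → δ ≤ |x - z|}, 0 < deriv F x := by
    intro x hx
    refine lt_of_le_of_ne (hF.deriv_nonneg x) fun h => ?_
    have := hx x h.symm
    rw [sub_self, abs_zero] at this
    linarith
  obtain ⟨M, hM, h⟩ := exists_bound_of_periodic (g := fun x => (deriv F x)⁻¹) hc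
    (fun x hx m z hz => by
      have := hx (z + (-m : ℤ)) (by rw [hF.deriv_add_int]; exact hz)
      rwa [show x - (z + ((-m : ℤ) : ℝ)) = x + m - z by push_cast; ring] at this)
    (hF.contDiff_deriv.continuous.continuousOn.inv₀ fun x hx => (hpos x hx).ne')
    (fun x m => by rw [hF.deriv_add_int])
  refine ⟨M⁻¹, inv_pos.2 hM, fun x hx => ?_⟩
  rw [inv_le_comm₀ hM (hpos x hx)]
  exact h x hx

theorem exists_le_sub {F : ℝ → ℝ} (hF : IsTameLift F) {t : ℝ} (ht : 0 < t) :
    ∃ δ, 0 < δ ∧ ∀ x, δ ≤ F (x + t) - F x := by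
  have hpos : ∀ x, 0 < F (x + t) - F x := fun x => sub_pos.2 (hF.strictMono (by linarith))
  have hc : Continuous F := hF.contDiff.continuous
  obtain ⟨M, hM, h⟩ := exists_bound_of_periodic (g := fun x => (F (x + t) - F x)⁻¹) isClosed_univ
    (fun _ _ _ => trivial)
    (Continuous.continuousOn (by
      refine Continuous.inv₀ (by fun_prop) fun x => (hpos x).ne'))
    (fun x m => by
      rw [show x + m + t = x + t + m by ring, hF.map_add_int, hF.map_add_int]
      congr 1; ring)
  refine ⟨M⁻¹, inv_pos.2 hM, fun x => ?_⟩
  rw [inv_le_comm₀ hM (hpos x)]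
  exact h x trivial

/-- The derivative at a point of an interval of bounded length is at most a constant times the mean
derivative on the interval. -/
theorem exists_deriv_mul_le {F : ℝ → ℝ} (hF : IsTameLift F) (D : ℝ) (hD : 0 < D) :
    ∃ C, 0 < C ∧ ∀ u x v, u ≤ x → x ≤ v → v ≤ u + D →
      deriv F x * (v - u) ≤ C * (F v - F u) := by
  obtain ⟨C₁, h₁⟩ := hF.exists_uniform (P := fun z C => 0 < C ∧ ∀ u x v, |u - z| < 1 / C →
      |v - z| < 1 / C → u ≤ x → x ≤ v → deriv F x * (v - u) ≤ C * (F v - F u)) (by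
    rintro z C C' hC ⟨h0, h⟩
    refine ⟨h0.trans_le hC, fun u x v hu hv hux hxv => ?_⟩
    have e : 1 / C' ≤ 1 / C := one_div_le_one_div_of_le h0 hC
    refine (h u x v (hu.trans_le e) (hv.trans_le e) hux hxv).trans ?_
    have := hF.strictMono.monotone (hux.trans hxv)
    gcongr) (by
    intro r α β s hr
    refine ⟨max (1 / r) (β / α * 2 ^ (s - 1) * 4), fun z _ h _ =>
      ⟨lt_max_of_lt_left (by positivity), fun u x v hu hv hux hxv => ?_⟩⟩
    have e : 1 / max (1 / r) (β / α * 2 ^ (s - 1) * 4) ≤ r := by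
      rw [one_div_le (lt_max_of_lt_left (by positivity)) hr]
      exact le_max_left _ _
    refine (h.deriv_mul_le hF.hasDerivAt hF.strictMono (hu.trans_le e) (hv.trans_le e)
      hux hxv).trans ?_
    have := sub_nonneg.2 (hF.strictMono.monotone (hux.trans hxv))
    gcongr
    exact le_max_right _ _)
  obtain ⟨r, hr, h₁⟩ : ∃ r, 0 < r ∧ ∀ z, deriv F z = 0 → ∀ u x v, |u - z| < r → |v - z| < r →
      u ≤ x → x ≤ v → deriv F x * (v - u) ≤ max C₁ 1 * (F v - F u) := by
    refine ⟨1 / max C₁ 1, by positivity, fun z hz u x v hu hv hux hxv => ?_⟩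
    have e : 1 / max C₁ 1 ≤ 1 / C₁ := one_div_le_one_div_of_le (h₁ z hz).1 (le_max_left _ _)
    refine ((h₁ z hz).2 u x v (hu.trans_le e) (hv.trans_le e) hux hxv).trans ?_
    have := sub_nonneg.2 (hF.strictMono.monotone (hux.trans hxv))
    gcongr
    exact le_max_left _ _
  obtain ⟨m₀, hm₀, hfar⟩ := hF.exists_le_deriv (half_pos hr)
  obtain ⟨M, hM, hbd⟩ := hF.exists_deriv_le
  obtain ⟨δ, hδ, hlong⟩ := hF.exists_le_sub (half_pos hr)
  refine ⟨max (max (M / m₀) (M * D / δ)) (max C₁ 1), by positivity, fun u x v hux hxv hv => ?_⟩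
  have huv := sub_nonneg.2 (hF.strictMono.monotone (hux.trans hxv))
  -- Three cases: a long interval has image of length at least `δ`; a short one coming within `r /
  -- 2` of a critical point lies in its `r`-neighbourhood, where the power law applies; on the
  -- remaining ones `F'` is at least `m₀`.
  rcases le_or_gt (u + r / 2) v with hl | hl
  · calc deriv F x * (v - u) ≤ M * D := by
          refine mul_le_mul (hbd x) (by linarith) (by linarith) hM.le
      _ = M * D / δ * δ := by field_simp
      _ ≤ M * D / δ * (F v - F u) := by
          gcongr
          have := hF.strictMono.monotone hl
          linarith [hlong u]
      _ ≤ _ := by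
          gcongr
          exact le_max_of_le_left (le_max_right _ _)
  by_cases hnear : ∃ z, deriv F z = 0 ∧ ∃ t, u ≤ t ∧ t ≤ v ∧ |t - z| < r / 2
  · obtain ⟨z, hz, t, h1, h2, h3⟩ := hnear
    rw [abs_lt] at h3
    refine (h₁ z hz u x v (abs_lt.2 ⟨by linarith, by linarith⟩)
      (abs_lt.2 ⟨by linarith, by linarith⟩) hux hxv).trans ?_
    exact mul_le_mul_of_nonneg_right (le_max_right _ _) huv
  · push Not at hnear
    rcases eq_or_lt_of_le (hux.trans hxv) with e | huv'
    · simp [e]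
    obtain ⟨ξ, h1, h2, e⟩ := exists_sub_eq_mul_of_hasDerivAt hF.hasDerivAt huv'
    have := hfar ξ (fun z hz => hnear z hz ξ h1.le h2.le)
    calc deriv F x * (v - u) ≤ M * (v - u) := by
          exact mul_le_mul_of_nonneg_right (hbd x) (by linarith)
      _ = M / m₀ * (m₀ * (v - u)) := by field_simp
      _ ≤ M / m₀ * (F v - F u) := by
          rw [e]
          gcongr
      _ ≤ _ := by
          gcongr
          exact le_max_of_le_left (le_max_left _ _)

/-- Close to a critical point negative Schwarzian derivative gives the factor 1. Elsewhere F' ≥ m₀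
and |F''| ≤ M, so `F'` varies on the interval by a factor of at most exp((M/m₀)(d - a)), which
enters once for each of the two ratios in the cross-ratio. -/
theorem exists_local_crossRatio_le {F : ℝ → ℝ} (hF : IsTameLift F) :
    ∃ ε C, 0 < ε ∧ 0 < C ∧ ∀ a b c d, a < b → b < c → c < d → d < a + ε →
      (∀ x ∈ Set.Icc a d, deriv F x ≠ 0) →
      crossRatio (F a) (F b) (F c) (F d) ≤ Real.exp (C * (d - a)) * crossRatio a b c d := by
  obtain ⟨C₁, h₁⟩ := hF.exists_uniform (P := fun z C => 0 < C ∧ ∀ x, |x - z| < 1 / C → x ≠ z →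
      schwarzian F x < 0) (by
    rintro z C C' hC ⟨h0, h⟩
    exact ⟨h0.trans_le hC, fun x hx => h x (hx.trans_le (one_div_le_one_div_of_le h0 hC))⟩) (by
    intro r α β s hr
    exact ⟨1 / r, fun z _ _ h => ⟨by positivity, by rwa [one_div_one_div]⟩⟩)
  obtain ⟨r, hr, h₁⟩ : ∃ r, 0 < r ∧ ∀ z, deriv F z = 0 → ∀ x, |x - z| < r → x ≠ z →
      schwarzian F x < 0 := by
    refine ⟨1 / max C₁ 1, by positivity, fun z hz x hx => ?_⟩
    exact (h₁ z hz).2 x (hx.trans_le (one_div_le_one_div_of_le (h₁ z hz).1 (le_max_left _ _)))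
  obtain ⟨m₀, hm₀, hfar⟩ := hF.exists_le_deriv (half_pos hr)
  obtain ⟨M, hM, hbd⟩ := hF.exists_deriv_deriv_le
  refine ⟨r / 2, 2 * (M / m₀), by positivity, by positivity, fun a b c d hab hbc hcd hd hZ => ?_⟩
  have hcr := crossRatio_pos hab hbc hcd
  by_cases hnear : ∃ z, deriv F z = 0 ∧ ∃ t, a ≤ t ∧ t ≤ d ∧ |t - z| < r / 2
  · obtain ⟨z, hz, t, h1, h2, h3⟩ := hnear
    rw [abs_lt] at h3
    refine (crossRatio_le_of_schwarzian_neg hF.contDiff hF.strictMono hab hbc hcd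
      (fun x hx => lt_of_le_of_ne (hF.deriv_nonneg x) (hZ x hx).symm)
      (fun x hx => h₁ z hz x (abs_lt.2 ⟨by linarith [hx.1], by linarith [hx.2]⟩)
        (fun e => hZ x hx (e ▸ hz)))).trans ?_
    refine le_mul_of_one_le_left hcr.le (Real.one_le_exp ?_)
    have : 0 < d - a := by linarith
    positivity
  push Not at hnear
  have hd1 : ∀ x, HasDerivAt (deriv F) (deriv (deriv F) x) x := fun x =>
    (hF.contDiff_deriv.differentiable (by norm_num) x).hasDerivAt
  have hcomp : ∀ x y, a ≤ x → x ≤ d → a ≤ y → y ≤ d →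
      deriv F x ≤ Real.exp (M / m₀ * (d - a)) * deriv F y := by
    intro x y hx1 hx2 hy1 hy2
    have hy := hfar y (fun z hz => hnear z hz y hy1 hy2)
    have hy0 : 0 < deriv F y := hm₀.trans_le hy
    have hlip : deriv F x - deriv F y ≤ M * (d - a) := by
      have := Convex.norm_image_sub_le_of_norm_deriv_le (f := deriv F) (C := M)
        (s := Set.univ) (x := y) (y := x) (fun x _ => (hd1 x).differentiableAt)
        (fun x _ => hbd x) convex_univ trivial trivial
      rw [Real.norm_eq_abs, Real.norm_eq_abs] at this
      refine (le_abs_self _).trans (this.trans ?_)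
      gcongr
      exact abs_le.2 ⟨by linarith, by linarith⟩
    calc deriv F x ≤ M / m₀ * (d - a) * m₀ + deriv F y := by
          have : M / m₀ * (d - a) * m₀ = M * (d - a) := by field_simp
          linarith
      _ ≤ M / m₀ * (d - a) * deriv F y + deriv F y := by
          gcongr
          have : 0 < d - a := by linarith
          positivity
      _ = (M / m₀ * (d - a) + 1) * deriv F y := by ring
      _ ≤ _ := by
          gcongr
          exact Real.add_one_le_exp _
  have mean : ∀ u v p q, a ≤ u → u < v → v ≤ d → a ≤ p → p < q → q ≤ d →
      (F q - F p) * (v - u) ≤ Real.exp (M / m₀ * (d - a)) * (F v - F u) * (q - p) := by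
    intro u v p q h1 h2 h3 h4 h5 h6
    obtain ⟨ξ, k1, k2, e⟩ := exists_sub_eq_mul_of_hasDerivAt hF.hasDerivAt h2
    obtain ⟨η, k3, k4, e'⟩ := exists_sub_eq_mul_of_hasDerivAt hF.hasDerivAt h5
    have := hcomp η ξ (by linarith) (by linarith) (by linarith) (by linarith)
    have i1 : 0 < v - u := by linarith
    have i2 : 0 < q - p := by linarith
    rw [e, e']
    calc _ = deriv F η * ((q - p) * (v - u)) := by ring
      _ ≤ Real.exp (M / m₀ * (d - a)) * deriv F ξ * ((q - p) * (v - u)) := by gcongr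
      _ = _ := by ring
  have := crossRatio_le_of_mean hF.strictMono hab hbc hcd (Real.exp_pos (M / m₀ * (d - a))).le
    (mean a c a b le_rfl (by linarith) hcd.le le_rfl hab (by linarith))
    (mean b d c d hab.le (by linarith) le_rfl (by linarith) hcd le_rfl)
  rwa [← Real.exp_add, show M / m₀ * (d - a) + M / m₀ * (d - a) = 2 * (M / m₀) * (d - a) by ring]
    at this

/-- This crude bound also covers intervals containing critical points: the mean of `F'` on a
subinterval is at most a constant times its mean on the whole interval. -/
theorem exists_crossRatio_le {F : ℝ → ℝ} (hF : IsTameLift F) (D : ℝ) (hD : 0 < D) :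
    ∃ B, 1 ≤ B ∧ ∀ a b c d, a < b → b < c → c < d → d ≤ a + D →
      crossRatio (F a) (F b) (F c) (F d) ≤ B * crossRatio a b c d := by
  obtain ⟨C, hC, h⟩ := hF.exists_deriv_mul_le D hD
  have mean : ∀ u v p q, u ≤ p → p < q → q ≤ v → v ≤ u + D →
      (F q - F p) * (v - u) ≤ C * (F v - F u) * (q - p) := by
    intro u v p q hu hpq hv hD
    obtain ⟨ξ, h1, h2, e⟩ := exists_sub_eq_mul_of_hasDerivAt hF.hasDerivAt hpq
    have := h u ξ v (by linarith) (by linarith) hD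
    calc _ = (deriv F ξ * (v - u)) * (q - p) := by rw [e]; ring
      _ ≤ _ := by gcongr
  refine ⟨max 1 (C * C), le_max_left _ _, fun a b c d hab hbc hcd hd => ?_⟩
  refine (crossRatio_le_of_mean hF.strictMono hab hbc hcd hC.le
    (mean a c a b le_rfl hab hbc.le (by linarith))
    (mean b d c d hbc.le hcd le_rfl (by linarith))).trans ?_
  have := crossRatio_pos hab hbc hcd
  gcongr
  exact le_max_right _ _

/-- At critical points, the ratio of the lengths of two adjacent intervals cannot be far from one
if it is not decreased much by `F`. -/
theorem exists_comparable {F : ℝ → ℝ} (hF : IsTameLift F) {κ : ℝ} (hκ : 0 < κ) :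
    ∃ C, 0 < C ∧ ∀ z, deriv F z = 0 → ∀ y w : ℝ, z - 1 ≤ y → y < z → z < w → w ≤ z + 1 →
      (κ * (z - y) * (F w - F z) ≤ (F z - F y) * (w - z) → w - z ≤ C * (z - y)) := by
  obtain ⟨C, hC⟩ := hF.exists_uniform (P := fun z C => ∀ y w : ℝ, z - 1 ≤ y → y < z → z < w →
      w ≤ z + 1 → (κ * (z - y) * (F w - F z) ≤ (F z - F y) * (w - z) → w - z ≤ C * (z - y))) (by
    intro z C C' hC h y w h1 h2 h3 h4 h5
    refine (h y w h1 h2 h3 h4 h5).trans ?_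
    gcongr) (by
    intro r α β s hr
    obtain ⟨C, -, hC⟩ := PowerLaw.exists_comparable hF.hasDerivAt hF.strictMono hF.map_add_one
      r α β s hκ
    exact ⟨C, fun z _ h _ => hC z h⟩)
  refine ⟨max C 1, by positivity, fun z hz y w h1 h2 h3 h4 h5 => ?_⟩
  refine (hC z hz y w h1 h2 h3 h4 h5).trans ?_
  gcongr
  exact le_max_left _ _

end IsTameLift

/-! ### Orbits of a lift with irrational rotation number -/

/-- The point `E^i x + m`. -/
def orb (E : ℝ ≃o ℝ) (i m : ℤ) (x : ℝ) : ℝ := (E ^ i) x + m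

/-- `E` is a lift of a circle homeomorphism, and its orbits are ordered as those of the translation
by the irrational number `ρ`. -/
structure IsRotationLike (E : ℝ ≃o ℝ) (ρ : ℝ) : Prop where
  irrational : Irrational ρ
  map_add_int : ∀ x, ∀ m : ℤ, E (x + m) = E x + m
  lt_orb : ∀ i m : ℤ, 0 < i * ρ + m → ∀ x, x < orb E i m x

theorem orb_zero_zero (E : ℝ ≃o ℝ) (x : ℝ) : orb E 0 0 x = x := by simp [orb]

theorem orb_strictMono (E : ℝ ≃o ℝ) (i m : ℤ) : StrictMono (orb E i m) := fun _ _ h => by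
  unfold orb; linarith [(E ^ i).strictMono h]

theorem orb_le_orb_iff (E : ℝ ≃o ℝ) {i m : ℤ} {x y : ℝ} : orb E i m x ≤ orb E i m y ↔ x ≤ y :=
  (orb_strictMono E i m).le_iff_le

theorem orb_lt_orb_iff (E : ℝ ≃o ℝ) {i m : ℤ} {x y : ℝ} : orb E i m x < orb E i m y ↔ x < y :=
  (orb_strictMono E i m).lt_iff_lt

theorem continuous_orb (E : ℝ ≃o ℝ) (i m : ℤ) : Continuous (orb E i m) :=
  (E ^ i).continuous.add continuous_const

theorem orb_natCast_zero (E : ℝ ≃o ℝ) (i : ℕ) (x : ℝ) : orb E i 0 x = E^[i] x := by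
  simp only [orb, zpow_natCast, Int.cast_zero, add_zero]
  induction i generalizing x with
  | zero => rfl
  | succ n ih => rw [pow_succ, Function.iterate_succ_apply, ← ih]; rfl

namespace IsRotationLike

theorem zpow_add_int {E : ℝ ≃o ℝ} {ρ : ℝ} (hE : IsRotationLike E ρ) (i : ℤ) (x : ℝ) (m : ℤ) :
    (E ^ i) (x + m) = (E ^ i) x + m := by
  have h1 : ∀ x, ∀ m : ℤ, E⁻¹ (x + m) = E⁻¹ x + m := by
    intro x m
    apply E.injective
    rw [hE.map_add_int]
    have : ∀ y, E (E⁻¹ y) = y := fun y => E.apply_symm_apply y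
    rw [this, this]
  induction i generalizing x with
  | zero => simp
  | succ n ih =>
    rw [zpow_add_one]
    change (E ^ (n : ℤ)) (E (x + m)) = (E ^ (n : ℤ)) (E x) + m
    rw [hE.map_add_int, ih]
  | pred n ih =>
    rw [zpow_sub_one]
    change (E ^ (-(n : ℤ))) (E⁻¹ (x + m)) = (E ^ (-(n : ℤ))) (E⁻¹ x) + m
    rw [h1, ih]

theorem orb_orb {E : ℝ ≃o ℝ} {ρ : ℝ} (hE : IsRotationLike E ρ) (i m j l : ℤ) (x : ℝ) :
    orb E i m (orb E j l x) = orb E (i + j) (m + l) x := by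
  simp only [orb]
  rw [hE.zpow_add_int, zpow_add]
  change (E ^ i) ((E ^ j) x) + l + m = (E ^ i) ((E ^ j) x) + _
  push_cast; ring

theorem orb_lt_orb {E : ℝ ≃o ℝ} {ρ : ℝ} (hE : IsRotationLike E ρ) {i m j l : ℤ}
    (h : i * ρ + m < j * ρ + l) (x : ℝ) : orb E i m x < orb E j l x := by
  have := hE.lt_orb (j - i) (l - m) (by push_cast; linarith) (orb E i m x)
  rwa [hE.orb_orb, sub_add_cancel, sub_add_cancel] at this

theorem orb_le_orb {E : ℝ ≃o ℝ} {ρ : ℝ} (hE : IsRotationLike E ρ) {i m j l : ℤ}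
    (h : i * ρ + m ≤ j * ρ + l) (x : ℝ) : orb E i m x ≤ orb E j l x := by
  rcases h.lt_or_eq with h | h
  · exact (hE.orb_lt_orb h x).le
  have hij : i = j := by
    by_contra hne
    have h1 : (((i - j : ℤ) : ℝ)) * ρ = ((l - m : ℤ) : ℝ) := by push_cast; linarith
    exact (hE.irrational.intCast_mul (sub_ne_zero.2 hne)).ne_int _ h1
  subst hij
  have : m = l := by
    have : (m : ℝ) = l := by linarith
    exact_mod_cast this
  rw [this]

theorem lt_of_orb_lt {E : ℝ ≃o ℝ} {ρ : ℝ} (hE : IsRotationLike E ρ) {i m j l : ℤ} {x : ℝ}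
    (h : orb E i m x < orb E j l x) : i * ρ + m < j * ρ + l := by
  by_contra! hle
  exact absurd (hE.orb_le_orb hle x) (not_le.2 h)

end IsRotationLike

/-- Two consecutive closest return times `q ≤ q'` of the rotation by `ρ`, where the first is a return
from the right. -/
structure ClosestReturns (ρ : ℝ) (q q' : ℕ) (p p' : ℤ) : Prop where
  pos : 0 < q
  le : q ≤ q'
  right : 0 < q * ρ - p
  left : q' * ρ - p' < 0
  decreasing : -(q' * ρ - p') < q * ρ - p
  lt_one : q * ρ - p < 1
  best : ∀ l : ℕ, 0 < l → l < q' → ∀ m : ℤ, q * ρ - p ≤ |l * ρ + m|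

/-! ### Disjointness of the first iterates of a closest return interval -/

theorem measurableSet_image_coe {s : Set ℝ} (hs : MeasurableSet s) {t : ℝ}
    (h : s ⊆ Set.Ioc t (t + 1)) : MeasurableSet ((fun x : ℝ => (x : Circle1)) '' s) := by
  have : (fun x : ℝ => (x : Circle1)) '' s =
      (fun c => ((AddCircle.measurableEquivIoc (1 : ℝ) t c : Set.Ioc t (t + 1)) : ℝ)) ⁻¹' s := by
    ext c
    constructor
    · rintro ⟨x, hx, rfl⟩
      have : (AddCircle.measurableEquivIoc (1 : ℝ) t (x : Circle1)) = ⟨x, h hx⟩ :=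
        (AddCircle.equivIoc (1 : ℝ) t).apply_symm_apply ⟨x, h hx⟩
      simp only [Set.mem_preimage, this]
      exact hx
    · intro hc
      exact ⟨_, hc, (AddCircle.equivIoc (1 : ℝ) t).symm_apply_apply c⟩
  rw [this]
  exact (measurable_subtype_coe.comp (AddCircle.measurableEquivIoc (1 : ℝ) t).measurable) hs

theorem volume_image_coe {s : Set ℝ} (hs : MeasurableSet s) {t : ℝ} (h : s ⊆ Set.Ioc t (t + 1)) :
    volume ((fun x : ℝ => (x : Circle1)) '' s) = volume s := by
  have hm := measurableSet_image_coe hs h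
  have hp := (AddCircle.measurePreserving_mk (1 : ℝ) t)
  rw [← hp.measure_preimage hm.nullMeasurableSet, Measure.restrict_apply (hp.measurable hm)]
  congr 1
  ext x
  constructor
  · rintro ⟨⟨y, hy, hxy⟩, hx⟩
    have := (AddCircle.coe_eq_coe_iff_of_mem_Ioc (h hy) hx).1 hxy
    rwa [← this]
  · exact fun hx => ⟨⟨x, hx, rfl⟩, h hx⟩

open Classical in
/-- The indicator of `Z` meeting the interval `(u, v]`. -/
noncomputable def hit (Z : Set ℝ) (u v : ℝ) : ℝ := if (Z ∩ Set.Ioc u v).Nonempty then 1 else 0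

theorem hit_nonneg (Z : Set ℝ) (u v : ℝ) : 0 ≤ hit Z u v := by
  unfold hit; split_ifs <;> norm_num

namespace ClosestReturns

/-- If two of the arcs met, the order of the orbit would give |(j - i)ρ + m| < qρ - p for some
integer m, with 0 < j - i < q', contrary to `best`. -/
theorem disjoint_image {E : ℝ ≃o ℝ} {ρ : ℝ} (hE : IsRotationLike E ρ) {q q' : ℕ} {p p' : ℤ}
    (hq : ClosestReturns ρ q q' p p') (y : ℝ) {i j : ℕ} (hij : i < j) (hj : j < q') :
    Disjoint ((fun x : ℝ => (x : Circle1)) '' Set.Ioc (orb E i 0 y) (orb E (i + q) (-p) y))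
      ((fun x : ℝ => (x : Circle1)) '' Set.Ioc (orb E j 0 y) (orb E (j + q) (-p) y)) := by
  rw [Set.disjoint_left]
  rintro _ ⟨s, hs, rfl⟩ ⟨t, ht, hst⟩
  obtain ⟨m, rfl⟩ := coe_eq_coe_iff_exists_int.1 hst.symm
  have e : ∀ k l : ℤ, orb E k l y + m = orb E k (l + m) y := fun k l => by
    simp only [orb]; push_cast; ring
  have h1 : orb E i 0 y < orb E (j + q) (-p + m) y := by
    rw [← e]; linarith [hs.1, ht.2]
  have h2 : orb E j (0 + m) y < orb E (i + q) (-p) y := by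
    rw [← e]; linarith [hs.2, ht.1]
  have h3 := hE.lt_of_orb_lt h1
  have h4 := hE.lt_of_orb_lt h2
  have hb := hq.best (j - i) (by omega) (by omega) m
  rw [Nat.cast_sub hij.le] at hb
  push_cast at h3 h4
  rcases abs_cases (((j : ℝ) - i) * ρ + m) with ⟨h5, _⟩ | ⟨h5, _⟩ <;> rw [h5] at hb <;> linarith

theorem sum_length_le_one {E : ℝ ≃o ℝ} {ρ : ℝ} (hE : IsRotationLike E ρ) {q q' : ℕ} {p p' : ℤ}
    (hq : ClosestReturns ρ q q' p p') (y : ℝ) :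
    ∑ i ∈ Finset.range q', (orb E (i + q) (-p) y - orb E i 0 y) ≤ 1 := by
  have hlt : ∀ i : ℕ, orb E i 0 y < orb E (i + q) (-p) y := fun i =>
    hE.orb_lt_orb (by push_cast; linarith [hq.right]) y
  have hlt1 : ∀ i : ℕ, orb E (i + q) (-p) y < orb E i 0 y + 1 := fun i => by
    have : orb E (i + q) (-p) y < orb E i 1 y :=
      hE.orb_lt_orb (by push_cast; linarith [hq.lt_one]) y
    simpa [orb] using this
  have hsub : ∀ i : ℕ, Set.Ioc (orb E i 0 y) (orb E (i + q) (-p) y) ⊆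
      Set.Ioc (orb E i 0 y) (orb E i 0 y + 1) := fun i =>
    Set.Ioc_subset_Ioc_right (hlt1 i).le
  have h1 := measure_biUnion_finset (μ := (volume : Measure Circle1)) (s := Finset.range q')
    (f := fun i => (fun x : ℝ => (x : Circle1)) '' Set.Ioc (orb E i 0 y) (orb E (i + q) (-p) y))
    (by
      intro i hi j hj hne
      rcases lt_or_gt_of_ne hne with h | h
      · exact hq.disjoint_image hE y h (by simpa using hj)
      · exact (hq.disjoint_image hE y h (by simpa using hi)).symm)
    (fun i _ => measurableSet_image_coe measurableSet_Ioc (hsub i))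
  have h2 : ∑ i ∈ Finset.range q', volume ((fun x : ℝ => (x : Circle1)) ''
      Set.Ioc (orb E i 0 y) (orb E (i + q) (-p) y)) ≤ 1 := by
    rw [← h1, ← UnitAddCircle.measure_univ]
    exact measure_mono (Set.subset_univ _)
  rw [Finset.sum_congr rfl (fun i _ => volume_image_coe measurableSet_Ioc (hsub i))] at h2
  simp only [Real.volume_Ioc] at h2
  rw [← ENNReal.ofReal_sum_of_nonneg (fun i _ => by linarith [hlt i])] at h2
  exact ENNReal.ofReal_le_one.1 h2

/-- A point of `Z` chosen in each interval that is hit gives an injection into `Z` modulo 1, because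
the arcs are disjoint. -/
theorem sum_hit_le {E : ℝ ≃o ℝ} {ρ : ℝ} (hE : IsRotationLike E ρ) {q q' : ℕ} {p p' : ℤ}
    (hq : ClosestReturns ρ q q' p p') {Z : Set ℝ}
    (hZ : ((fun x : ℝ => (x : Circle1)) '' Z).Finite) (y : ℝ) :
    ∑ i ∈ Finset.range q', hit Z (orb E i 0 y) (orb E (i + q) (-p) y) ≤ hZ.toFinset.card := by
  classical
  unfold hit
  rw [Finset.sum_boole]
  norm_cast
  have hch : ∀ i : ℕ, ∃ z, (Z ∩ Set.Ioc (orb E i 0 y) (orb E (i + q) (-p) y)).Nonempty →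
      z ∈ Z ∩ Set.Ioc (orb E i 0 y) (orb E (i + q) (-p) y) := fun i => by
    by_cases h : (Z ∩ Set.Ioc (orb E i 0 y) (orb E (i + q) (-p) y)).Nonempty
    · exact ⟨h.some, fun _ => h.some_mem⟩
    · exact ⟨0, fun h' => absurd h' h⟩
  choose z hz using hch
  refine Finset.card_le_card_of_injOn (fun i => (z i : Circle1)) ?_ ?_
  · intro i hi
    rw [Finset.mem_coe, Finset.mem_filter] at hi
    simp only [Set.Finite.coe_toFinset]
    exact ⟨z i, (hz i hi.2).1, rfl⟩
  · intro i hi j hj hij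
    rw [Finset.mem_coe, Finset.mem_filter, Finset.mem_range] at hi hj
    by_contra hne
    rcases lt_or_gt_of_ne hne with h | h
    · refine Set.disjoint_left.1 (hq.disjoint_image hE y h hj.1) ⟨z i, (hz i hi.2).2, rfl⟩ ?_
      exact ⟨z j, (hz j hj.2).2, hij.symm⟩
    · refine Set.disjoint_left.1 (hq.disjoint_image hE y h hi.1) ⟨z j, (hz j hj.2).2, rfl⟩ ?_
      exact ⟨z i, (hz i hi.2).2, hij⟩

end ClosestReturns

/-! ### The cross-ratio inequality -/

theorem hit_le_add (Z : Set ℝ) (u v w : ℝ) :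
    hit Z u w ≤ hit Z u v + hit Z v w := by
  by_cases h : (Z ∩ Set.Ioc u w).Nonempty
  · obtain ⟨z, hz, h1, h2⟩ := h
    rcases le_or_gt z v with hv | hv
    · have : hit Z u v = 1 := if_pos ⟨z, hz, h1, hv⟩
      have h3 := hit_nonneg Z v w
      have : hit Z u w = 1 := if_pos ⟨z, hz, h1, h2⟩
      linarith
    · have : hit Z v w = 1 := if_pos ⟨z, hz, hv, h2⟩
      have h3 := hit_nonneg Z u v
      have : hit Z u w = 1 := if_pos ⟨z, hz, h1, h2⟩
      linarith
  · have : hit Z u w = 0 := if_neg h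
    rw [this]
    exact add_nonneg (hit_nonneg _ _ _) (hit_nonneg _ _ _)

theorem hit_le_sum (Z : Set ℝ) (t : ℕ → ℝ) (n : ℕ) :
    hit Z (t 0) (t n) ≤
      ∑ j ∈ Finset.range n, hit Z (t j) (t (j + 1)) := by
  induction n with
  | zero => simp [hit]
  | succ n ih =>
    rw [Finset.sum_range_succ]
    exact (hit_le_add Z _ (t n) _).trans (by linarith)

theorem hit_mono_right (Z : Set ℝ) {u v w : ℝ} (h : v ≤ w) :
    hit Z u v ≤ hit Z u w := by
  by_cases h' : (Z ∩ Set.Ioc u v).Nonempty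
  · obtain ⟨z, hz, h1, h2⟩ := h'
    rw [hit, hit, if_pos ⟨z, hz, h1, h2⟩,
      if_pos ⟨z, hz, h1, h2.trans h⟩]
  · rw [hit, if_neg h']
    exact hit_nonneg _ _ _

namespace IsTameLift

/-- The distortion of cross-ratios under one iterate. -/
theorem exists_crossRatio_le_exp {F : ℝ → ℝ} (hF : IsTameLift F) :
    ∃ β γ, 0 ≤ β ∧ 0 ≤ γ ∧ ∀ u a b c d, u < a → a < b → b < c → c < d → d ≤ a + 4 →
      crossRatio (F a) (F b) (F c) (F d) ≤
        Real.exp (β * hit {x | deriv F x = 0} u d + γ * (d - a)) *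
          crossRatio a b c d := by
  obtain ⟨ε, C, hε, hC, h₁⟩ := hF.exists_local_crossRatio_le
  obtain ⟨B, hB, h₂⟩ := hF.exists_crossRatio_le 4 (by norm_num)
  have hlog : 0 ≤ Real.log B := Real.log_nonneg hB
  refine ⟨Real.log B, C + Real.log B / ε, hlog, by positivity,
    fun u a b c d hu hab hbc hcd hd => ?_⟩
  have hcr := crossRatio_pos hab hbc hcd
  have had : 0 < d - a := by linarith
  have hh := hit_nonneg {x | deriv F x = 0} u d
  have big : Real.log B ≤ Real.log B * hit {x | deriv F x = 0} u d +
      (C + Real.log B / ε) * (d - a) →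
      -- The crude bound `B` suffices once the exponent reaches `log B`. A critical point in `[a,
      -- d]` ensures this through `hit`, and a length of at least `ε` through the coefficient `log B
      -- / ε`.
      crossRatio (F a) (F b) (F c) (F d) ≤
        Real.exp (Real.log B * hit {x | deriv F x = 0} u d +
          (C + Real.log B / ε) * (d - a)) * crossRatio a b c d := by
    intro h
    refine (h₂ a b c d hab hbc hcd hd).trans ?_
    gcongr
    calc B = Real.exp (Real.log B) := (Real.exp_log (by linarith)).symm
      _ ≤ _ := Real.exp_le_exp.2 h
  by_cases h : ∀ x ∈ Set.Icc a d, deriv F x ≠ 0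
  · rcases lt_or_ge d (a + ε) with hlt | hge
    · refine (h₁ a b c d hab hbc hcd hlt h).trans ?_
      gcongr
      have : 0 ≤ Real.log B * hit {x | deriv F x = 0} u d +
        Real.log B / ε * (d - a) := by positivity
      linarith
    · apply big
      have : Real.log B ≤ Real.log B / ε * (d - a) := by
        rw [div_mul_eq_mul_div, le_div_iff₀ hε]
        gcongr
        linarith
      have : 0 ≤ Real.log B * hit {x | deriv F x = 0} u d + C * (d - a) := by
        positivity
      linarith
  · push Not at h
    obtain ⟨x, hx, hx0⟩ := h
    apply big
    -- `hit` refers to the half-open interval `(u, d]`; the strict inequality `u < a` is what makes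
    -- a critical point at `a` itself count.
    have : hit {x | deriv F x = 0} u d = 1 :=
      if_pos ⟨x, hx0, by linarith [hx.1], hx.2⟩
    rw [this, mul_one]
    have : 0 ≤ (C + Real.log B / ε) * (d - a) := by positivity
    linarith

/-- The one-step factors multiply, so their exponents add. Each iterate of `[a, d]` lies in a union
of four consecutive closest return intervals; for each of the four, the critical hits over `q'`
iterates number at most `N` and the lengths sum to at most 1. -/
theorem exists_crossRatio_orb_le_aux {E : ℝ ≃o ℝ} {ρ : ℝ} (hF : IsTameLift E)
    (hE : IsRotationLike E ρ) :
    ∃ B, 1 ≤ B ∧ ∀ {q q' : ℕ} {p p' : ℤ}, ClosestReturns ρ q q' p p' → ∀ {x a b c d : ℝ}, x ≤ a →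
      a < b → b < c → c < d → d ≤ orb E (3 * q) (-(3 * p)) x → ∀ m : ℕ, m ≤ q' →
      crossRatio (orb E m 0 a) (orb E m 0 b) (orb E m 0 c) (orb E m 0 d) ≤
        B * crossRatio a b c d := by
  obtain ⟨β, γ, hβ, hγ, h⟩ := hF.exists_crossRatio_le_exp
  set Z := {x | deriv E x = 0} with hZ
  set N : ℝ := ((hF.finite.toFinset.card : ℕ) : ℝ) with hN
  refine ⟨Real.exp (β * (4 * N) + γ * 4), Real.one_le_exp (by positivity), ?_⟩
  intro q q' p p' hq x a b c d hxa hab hbc hcd hd m hm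
  -- The endpoints of the four intervals. The subtraction is in ℤ: `j = 0` is one return to the left
  -- of `x`, which makes `t i 0` strictly smaller than the image of `a`.
  set t : ℕ → ℕ → ℝ := fun i j => orb E (i + (j - 1) * q) (-((j - 1) * p)) x with ht
  have hsucc : ∀ (i : ℕ) (y : ℝ), orb E (i + 1 : ℕ) 0 y = E (orb E i 0 y) := by
    intro i y
    rw [orb_natCast_zero, orb_natCast_zero, Function.iterate_succ_apply']
  have hθ := hq.right
  have hθ1 := hq.lt_one
  have ha : ∀ i : ℕ, t i 0 < orb E i 0 a := by
    intro i
    refine lt_of_lt_of_le ?_ ((orb_le_orb_iff E).2 hxa)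
    exact hE.orb_lt_orb (by push_cast; linarith) x
  have hd' : ∀ i : ℕ, orb E i 0 d ≤ t i 4 := by
    intro i
    refine ((orb_le_orb_iff E).2 hd).trans ?_
    rw [hE.orb_orb]
    exact hE.orb_le_orb (by push_cast; linarith) x
  have h4 : ∀ i : ℕ, t i 4 ≤ t i 0 + 4 := by
    intro i
    have : t i 4 < orb E (i + ((0 : ℕ) - 1) * q) (-(((0 : ℕ) - 1) * p) + 4) x :=
      hE.orb_lt_orb (by push_cast; linarith) x
    refine this.le.trans (le_of_eq ?_)
    simp only [ht, orb]; push_cast; ring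
  have step : ∀ m : ℕ, crossRatio (orb E m 0 a) (orb E m 0 b) (orb E m 0 c) (orb E m 0 d) ≤
      Real.exp (∑ i ∈ Finset.range m, (β * hit Z (t i 0) (t i 4) +
        γ * (t i 4 - t i 0))) * crossRatio a b c d := by
    intro m
    induction m with
    | zero => simp [orb_zero_zero]
    | succ m ih =>
      rw [hsucc, hsucc, hsucc, hsucc, Finset.sum_range_succ, add_comm (Finset.sum _ _),
        Real.exp_add, mul_assoc]
      refine (h (t m 0) _ _ _ _ (ha m) ((orb_lt_orb_iff E).2 hab) ((orb_lt_orb_iff E).2 hbc)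
        ((orb_lt_orb_iff E).2 hcd) (by linarith [ha m, hd' m, h4 m])).trans ?_
      refine mul_le_mul (Real.exp_le_exp.2 (add_le_add ?_ ?_)) ih (crossRatio_pos
        ((orb_lt_orb_iff E).2 hab) ((orb_lt_orb_iff E).2 hbc)
        ((orb_lt_orb_iff E).2 hcd)).le (Real.exp_pos _).le
      · exact mul_le_mul_of_nonneg_left (hit_mono_right Z (hd' m)) hβ
      · exact mul_le_mul_of_nonneg_left (by linarith [ha m, hd' m]) hγ
  refine (step m).trans ?_
  have hcr := crossRatio_pos hab hbc hcd
  gcongr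
  have ht' : ∀ i j : ℕ, t i j = orb E i 0 (orb E ((j - 1) * q) (-((j - 1) * p)) x) ∧
      t i (j + 1) = orb E (i + q) (-p) (orb E ((j - 1) * q) (-((j - 1) * p)) x) := by
    intro i j
    rw [hE.orb_orb, hE.orb_orb]
    constructor
    · simp only [ht]; congr 1; ring
    · simp only [ht]; congr 1 <;> push_cast <;> ring
  have hpos : ∀ i : ℕ, 0 ≤ β * hit Z (t i 0) (t i 4) + γ * (t i 4 - t i 0) := by
    intro i
    have h1 := hit_nonneg Z (t i 0) (t i 4)
    have h2 : 0 < t i 4 - t i 0 := by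
      have : orb E i 0 a < orb E i 0 d := (orb_lt_orb_iff E).2 (by linarith)
      linarith [ha i, hd' i]
    positivity
  calc _ ≤ ∑ i ∈ Finset.range q', (β * hit Z (t i 0) (t i 4) +
        γ * (t i 4 - t i 0)) :=
        Finset.sum_le_sum_of_subset_of_nonneg (Finset.range_subset_range.2 hm)
          fun i _ _ => hpos i
    _ = β * (∑ i ∈ Finset.range q', hit Z (t i 0) (t i 4)) +
        γ * ∑ i ∈ Finset.range q', (t i 4 - t i 0) := by
        rw [Finset.sum_add_distrib, Finset.mul_sum, Finset.mul_sum]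
    _ ≤ β * (4 * N) + γ * 4 := by
        gcongr
        · calc _ ≤ ∑ i ∈ Finset.range q', ∑ j ∈ Finset.range 4,
                hit Z (t i j) (t i (j + 1)) :=
                Finset.sum_le_sum fun i _ => hit_le_sum Z (t i) 4
            _ = ∑ j ∈ Finset.range 4, ∑ i ∈ Finset.range q',
                hit Z (t i j) (t i (j + 1)) := Finset.sum_comm
            _ ≤ ∑ j ∈ Finset.range 4, N := by
                refine Finset.sum_le_sum fun j _ => le_trans (Finset.sum_le_sum fun i _ => ?_)
                  (hq.sum_hit_le hE hF.finite (orb E ((j - 1) * q) (-((j - 1) * p)) x))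
                exact le_of_eq (by rw [(ht' i j).2, (ht' i j).1])
            _ = 4 * N := by simp
        · calc _ = ∑ i ∈ Finset.range q', ∑ j ∈ Finset.range 4, (t i (j + 1) - t i j) :=
                Finset.sum_congr rfl fun i _ => (Finset.sum_range_sub (t i) 4).symm
            _ = ∑ j ∈ Finset.range 4, ∑ i ∈ Finset.range q', (t i (j + 1) - t i j) :=
                Finset.sum_comm
            _ ≤ ∑ j ∈ Finset.range 4, (1 : ℝ) := by
                refine Finset.sum_le_sum fun j _ => le_trans (Finset.sum_le_sum fun i _ => ?_)
                  (hq.sum_length_le_one hE (orb E ((j - 1) * q) (-((j - 1) * p)) x))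
                exact le_of_eq (by rw [(ht' i j).2, (ht' i j).1])
            _ = 4 := by simp

/-- **Cross-ratio inequality.** -/
theorem exists_crossRatio_orb_le {E : ℝ ≃o ℝ} {ρ : ℝ} (hF : IsTameLift E)
    (hE : IsRotationLike E ρ) :
    ∃ B, 1 ≤ B ∧ ∀ {q q' : ℕ} {p p' : ℤ}, ClosestReturns ρ q q' p p' → ∀ {x a b c d : ℝ}, x ≤ a →
      a < b → b < c → c < d → d ≤ orb E (3 * q) (-(3 * p)) x → ∀ m : ℕ, m ≤ 3 * q' → ∀ l : ℤ,
      crossRatio (orb E m l a) (orb E m l b) (orb E m l c) (orb E m l d) ≤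
        B * crossRatio a b c d := by
  obtain ⟨B, hB, h⟩ := hF.exists_crossRatio_orb_le_aux hE
  refine ⟨B ^ 3, one_le_pow₀ hB, ?_⟩
  intro q q' p p' hq x a b c d hxa hab hbc hcd hd m hm l
  -- The hypotheses are inherited by the images under `E ^ q'`, so every further block of at most
  -- `q'` iterates costs one more factor `B`.
  have main : ∀ k : ℕ, ∀ {x a b c d : ℝ}, x ≤ a →
      a < b → b < c → c < d → d ≤ orb E (3 * q) (-(3 * p)) x → ∀ m : ℕ, m ≤ k * q' →
      crossRatio (orb E m 0 a) (orb E m 0 b) (orb E m 0 c) (orb E m 0 d) ≤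
        B ^ k * crossRatio a b c d := by
    intro k
    induction k with
    | zero =>
      intro x a b c d hxa hab hbc hcd hd m hm
      obtain rfl : m = 0 := by omega
      simp [orb_zero_zero]
    | succ k ih =>
      intro x a b c d hxa hab hbc hcd hd m hm
      have hcr := crossRatio_pos hab hbc hcd
      rcases le_or_gt m q' with hle | hlt
      · refine (h hq hxa hab hbc hcd hd m hle).trans ?_
        gcongr
        exact le_self_pow₀ hB (by omega)
      · obtain ⟨m', rfl⟩ : ∃ m', m = m' + q' := ⟨m - q', by omega⟩
        have e : ∀ y, orb E ((m' + q' : ℕ) : ℤ) 0 y = orb E m' 0 (orb E q' 0 y) := by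
          intro y
          rw [hE.orb_orb]; push_cast; rfl
        rw [e, e, e, e]
        have h1 := ih (x := orb E q' 0 x) ((orb_le_orb_iff E).2 hxa) ((orb_lt_orb_iff E).2 hab)
          ((orb_lt_orb_iff E).2 hbc) ((orb_lt_orb_iff E).2 hcd) (by
            refine ((orb_le_orb_iff E).2 hd).trans (le_of_eq ?_)
            rw [hE.orb_orb, hE.orb_orb, add_comm, zero_add, add_zero]) m'
          (by rw [Nat.succ_mul] at hm; omega)
        refine h1.trans ?_
        rw [pow_succ, mul_assoc]
        have := h hq hxa hab hbc hcd hd q' le_rfl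
        gcongr
  have e : ∀ y, orb E m l y = orb E m 0 y + l := fun y => by simp [orb]
  have := main 3 hxa hab hbc hcd hd m hm
  rw [e, e, e, e]
  simpa only [crossRatio, add_sub_add_right_eq_sub] using this

end IsTameLift

/-! ### Real bounds -/

/-- If the middle interval `(b', c')` is at most `D` times as long as its neighbours, then so is
`(b, c)`, up to a constant, when the cross-ratio of `a, b, c, d` is not much smaller. -/
theorem sub_le_of_crossRatio_le {a b c d a' b' c' d' B D : ℝ} (hab : a < b) (hbc : b < c)
    (hcd : c < d) (hab' : a' < b') (hbc' : b' < c') (hcd' : c' < d') (hB : 1 ≤ B) (hD : 0 ≤ D)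
    (h : crossRatio a' b' c' d' ≤ B * crossRatio a b c d)
    (hL : c' - b' ≤ D * (b' - a')) (hR : c' - b' ≤ D * (d' - c')) :
    c - b ≤ B * (1 + D) ^ 2 * (b - a) ∧ c - b ≤ B * (1 + D) ^ 2 * (d - c) := by
  have i1 : 0 < b - a := by linarith
  have i2 : 0 < c - b := by linarith
  have i3 : 0 < d - c := by linarith
  have i4 : 0 < c - a := by linarith
  have i5 : 0 < d - b := by linarith
  have j1 : 0 < b' - a' := by linarith
  have j3 : 0 < d' - c' := by linarith
  have j4 : 0 < c' - a' := by linarith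
  have j5 : 0 < d' - b' := by linarith
  -- Each of the two ratios in the cross-ratio of the images is at least 1/(1 + D). For the original
  -- points, the cross-ratio is at most the ratio of either neighbour to the middle interval.
  have k0 : 1 ≤ (1 + D) ^ 2 * crossRatio a' b' c' d' := by
    unfold crossRatio
    rw [← mul_div_assoc, one_le_div (by positivity)]
    calc (c' - a') * (d' - b') ≤ ((1 + D) * (b' - a')) * ((1 + D) * (d' - c')) := by
          refine mul_le_mul ?_ ?_ j5.le (by positivity) <;> linarith
      _ = _ := by ring
  have k1 : 1 ≤ B * (1 + D) ^ 2 * crossRatio a b c d := by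
    calc (1 : ℝ) ≤ (1 + D) ^ 2 * crossRatio a' b' c' d' := k0
      _ ≤ (1 + D) ^ 2 * (B * crossRatio a b c d) := by gcongr
      _ = _ := by ring
  have e : 0 ≤ B * (1 + D) ^ 2 := by positivity
  constructor
  · have : crossRatio a b c d ≤ (b - a) / (c - b) := by
      unfold crossRatio
      rw [mul_div_mul_comm]
      calc (b - a) / (c - a) * ((d - c) / (d - b)) ≤ (b - a) / (c - b) * 1 := by
            gcongr
            rw [div_le_one i5]; linarith
        _ = _ := mul_one _
    have := k1.trans (mul_le_mul_of_nonneg_left this e)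
    rwa [← mul_div_assoc, one_le_div i2] at this
  · have : crossRatio a b c d ≤ (d - c) / (c - b) := by
      unfold crossRatio
      rw [mul_div_mul_comm]
      calc (b - a) / (c - a) * ((d - c) / (d - b)) ≤ 1 * ((d - c) / (c - b)) := by
            gcongr
            rw [div_le_one i4]; linarith
        _ = _ := one_mul _
    have := k1.trans (mul_le_mul_of_nonneg_left this e)
    rwa [← mul_div_assoc, one_le_div i2] at this

/-- Every closest return interval contains one of the first `q + q'` points of any orbit. -/
theorem ClosestReturns.exists_orb_mem {E : ℝ ≃o ℝ} {ρ : ℝ} (hE : IsRotationLike E ρ) {q q' : ℕ}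
    {p p' : ℤ} (hq : ClosestReturns ρ q q' p p') (x z : ℝ) :
    ∃ j : ℕ, ∃ m : ℤ, j < q + q' ∧ orb E (-q) p z < orb E j m x ∧ orb E j m x ≤ z := by
  have hpos := hq.pos
  -- Among the first `q + q'` orbit points and their integer translates, the one closest to `z` from
  -- the left is taken.
  obtain ⟨j, hj, hmax⟩ := Finset.exists_max_image (Finset.range (q + q'))
    (fun j : ℕ => orb E j ⌊z - orb E j 0 x⌋ x) ⟨0, by simp; omega⟩
  rw [Finset.mem_range] at hj
  have hsplit : ∀ (i m : ℤ), orb E i m x = orb E i 0 x + m := fun i m => by simp [orb]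
  have hle : ∀ (i : ℕ) (m : ℤ), i < q + q' → orb E i m x ≤ z →
      orb E i m x ≤ orb E j ⌊z - orb E j 0 x⌋ x := by
    intro i m hi him
    refine le_trans ?_ (hmax i (Finset.mem_range.2 hi))
    have h1 : m ≤ ⌊z - orb E i 0 x⌋ := Int.le_floor.2 (by rw [hsplit] at him; linarith)
    have h2 : (m : ℝ) ≤ ⌊z - orb E i 0 x⌋ := by exact_mod_cast h1
    change orb E i m x ≤ orb E i ⌊z - orb E i 0 x⌋ x
    rw [hsplit i m, hsplit i ⌊z - orb E i 0 x⌋]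
    linarith
  refine ⟨j, ⌊z - orb E j 0 x⌋, hj, ?_, ?_⟩
  · obtain ⟨m, hm⟩ : ∃ m, m = ⌊z - orb E j 0 x⌋ := ⟨_, rfl⟩
    rw [← hm] at hle ⊢
    -- The next point to the right must lie beyond `z`, by maximality. It is reached by adding `q`
    -- to the index if `j < q'`; otherwise by subtracting `q'`, which moves less far than adding
    -- `q`.
    have key : z < orb E (j + q) (m - p) x := by
      rcases lt_or_ge j q' with h | h
      · by_contra! hcon
        have := hle (j + q) (m - p) (by omega) (by push_cast; exact hcon)
        push_cast at this
        exact absurd (hE.orb_lt_orb (i := j) (m := m) (j := j + q) (l := m - p)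
          (by push_cast; linarith [hq.right]) x) (not_lt.2 this)
      · have h1 : z < orb E ((j - q' : ℕ) : ℤ) (m + p') x := by
          by_contra! hcon
          have := hle (j - q') (m + p') (by omega) hcon
          exact absurd (hE.orb_lt_orb (i := j) (m := m) (j := (j - q' : ℕ)) (l := m + p')
            (by push_cast [Nat.cast_sub h]; linarith [hq.left]) x) (not_lt.2 this)
        refine h1.trans (hE.orb_lt_orb ?_ x)
        push_cast [Nat.cast_sub h]; linarith [hq.decreasing]
    have := (orb_lt_orb_iff E (i := -q) (m := p)).2 key
    rw [hE.orb_orb] at this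
    convert this using 2 <;> ring
  · rw [hsplit]
    linarith [Int.floor_le (z - orb E j 0 x)]

/-- Adjacent closest return intervals at any point of the circle are comparable. -/
theorem IsTameLift.exists_adjacent_le {E : ℝ ≃o ℝ} {ρ : ℝ} (hF : IsTameLift E)
    (hE : IsRotationLike E ρ) :
    ∃ C, 1 ≤ C ∧ ∀ {q q' : ℕ} {p p' : ℤ}, ClosestReturns ρ q q' p p' → ∀ x,
      orb E q (-p) x - x ≤ C * (x - orb E (-q) p x) ∧
      x - orb E (-q) p x ≤ C * (orb E q (-p) x - x) := by
  obtain ⟨B, hB, hcri⟩ := hF.exists_crossRatio_orb_le hE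
  set K := B * (1 + 1) ^ 2 with hK
  have hK1 : 1 ≤ K := by rw [hK]; linarith
  set D := 2 * (K * K) with hD
  have hD0 : 0 ≤ D := by positivity
  have hC1 : 1 ≤ B * (1 + D) ^ 2 := one_le_mul_of_one_le_of_one_le hB (one_le_pow₀ (by linarith))
  refine ⟨B * (1 + D) ^ 2, hC1, ?_⟩
  intro q q' p p' hq
  have hθ := hq.right
  have hqq := hq.le
  have hc : Continuous fun x => orb E q (-p) x - x := (continuous_orb E _ _).sub continuous_id
  -- The displacement is periodic and continuous, so it attains its minimum. The interval `[z, X 1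
  -- z]` is then no longer than any other closest return interval, in particular than its
  -- neighbours.
  obtain ⟨z, hz⟩ : ∃ z, ∀ x, orb E q (-p) z - z ≤ orb E q (-p) x - x := by
    obtain ⟨z, -, hz⟩ := isCompact_Icc.exists_isMinOn (Set.nonempty_Icc.2 (zero_le_one' ℝ))
      hc.continuousOn
    refine ⟨z, fun x => ?_⟩
    have e := hz (show Int.fract x ∈ Set.Icc (0 : ℝ) 1 from
      ⟨Int.fract_nonneg x, (Int.fract_lt_one x).le⟩)
    refine e.trans (le_of_eq ?_)
    have : Int.fract x = x + ((-⌊x⌋ : ℤ) : ℝ) := by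
      rw [Int.cast_neg, ← sub_eq_add_neg, Int.self_sub_floor]
    rw [this]
    simp only [orb]
    rw [hE.zpow_add_int]
    ring
  set X : ℤ → ℝ → ℝ := fun k x => orb E (k * q) (-(k * p)) x with hX
  have hXX : ∀ k l x, X k (X l x) = X (k + l) x := fun k l x => by
    simp only [hX]; rw [hE.orb_orb]; congr 1 <;> ring
  have hX1 : ∀ x, X 1 x = orb E q (-p) x := fun x => by simp [hX]
  have hXm : ∀ x, X (-1) x = orb E (-q) p x := fun x => by simp [hX]
  have hX0 : ∀ x, X 0 x = x := fun x => by simp [hX, orb_zero_zero]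
  have hlt : ∀ k l x, k < l → X k x < X l x := fun k l x hkl => by
    refine hE.orb_lt_orb ?_ x
    have : (k : ℝ) < l := by exact_mod_cast hkl
    push_cast
    nlinarith
  simp only [← hX1, ← hXm] at hz ⊢
  have hz' : ∀ k x, X 1 z - z ≤ X (k + 1) x - X k x := fun k x => by
    have := hz (X k x)
    rwa [hXX, add_comm 1 k] at this
  have pull : ∀ (m : ℕ) (l : ℤ) (k : ℤ) (x D : ℝ), 0 ≤ D → m ≤ 3 * q' →
      (X (k + 1) (orb E m l x) - X k (orb E m l x)) ≤
        D * (X k (orb E m l x) - X (k - 1) (orb E m l x)) →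
      (X (k + 1) (orb E m l x) - X k (orb E m l x)) ≤
        D * (X (k + 2) (orb E m l x) - X (k + 1) (orb E m l x)) →
      X (k + 1) x - X k x ≤ B * (1 + D) ^ 2 * (X k x - X (k - 1) x) ∧
      X (k + 1) x - X k x ≤ B * (1 + D) ^ 2 * (X (k + 2) x - X (k + 1) x) := by
    intro m l k x D hD hm h1 h2
    have comm : ∀ k, X k (orb E m l x) = orb E m l (X k x) := fun k => by
      simp only [hX]; rw [hE.orb_orb, hE.orb_orb]; congr 1 <;> ring
    rw [comm, comm, comm] at h1 h2
    have o1 := hlt (k - 1) k x (by omega)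
    have o2 := hlt k (k + 1) x (by omega)
    have o3 := hlt (k + 1) (k + 2) x (by omega)
    refine sub_le_of_crossRatio_le o1 o2 o3 ((orb_lt_orb_iff E).2 o1) ((orb_lt_orb_iff E).2 o2)
      ((orb_lt_orb_iff E).2 o3) hB hD ?_ h1 h2
    refine hcri hq (x := X (k - 1) x) le_rfl o1 o2 o3 ?_ m hm l
    rw [show orb E (3 * q) (-(3 * p)) (X (k - 1) x) = X 3 (X (k - 1) x) from rfl, hXX]
    exact le_of_eq (by congr 1; ring)
  have hXorb : ∀ (j : ℕ) x, X j x = orb E ((j * q : ℕ) : ℤ) (-(j * p)) x := fun j x => by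
    simp [hX]
  -- After one return (two returns for `d2`) the interval becomes `[z, X 1 z]`, so the pullback
  -- applies with `D = 1`.
  have d1 : X 0 z - X (-1) z ≤ K * (X 1 z - z) := by
    have := (pull (1 * q) (-((1 : ℕ) * p)) (-1) z 1 zero_le_one (by omega)
      (by simp only [← hXorb, hXX]; simpa [hX0] using hz' (-1) z)
      (by simp only [← hXorb, hXX]; simpa [hX0] using hz' 1 z)).2
    simpa [hX0] using this
  have d2 : X (-1) z - X (-2) z ≤ K * (X 0 z - X (-1) z) := by
    have := (pull (2 * q) (-((2 : ℕ) * p)) (-2) z 1 zero_le_one (by omega)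
      (by simp only [← hXorb, hXX, one_mul]; simpa [hX0] using hz' (-1) z)
      (by simp only [← hXorb, hXX, one_mul]; simpa [hX0] using hz' 1 z)).2
    simpa using this
  have hμ : 0 < X 1 z - z := by have := hlt 0 1 z (by omega); rw [hX0] at this; linarith
  -- Here `[y, X 1 y]` lies in `[X (-2) z, z]`, whose length is at most `K + K * K` times the
  -- minimal displacement.
  have near : ∀ y, X (-2) z ≤ y → y ≤ X (-1) z → X 1 y - X 0 y ≤ D * (X 1 z - z) := by
    intro y h1 h2
    have h3 : X 1 y ≤ X 0 z := by
      have := (orb_le_orb_iff E (i := 1 * q) (m := -(1 * p))).2 h2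
      change X 1 y ≤ X 1 (X (-1) z) at this
      rwa [hXX] at this
    rw [hX0 y]
    have : K * (X 0 z - X (-1) z) ≤ K * (K * (X 1 z - z)) := by gcongr
    have : K * (X 1 z - z) ≤ K * (K * (X 1 z - z)) := by
      apply mul_le_mul_of_nonneg_left _ (by linarith)
      exact le_mul_of_one_le_left hμ.le hK1
    rw [hD]
    linarith
  -- Some iterate of `x` of order below `q + q'` comes to `[X (-2) z, X (-1) z]`. There the return
  -- interval is at most `D` times the minimum, hence at most `D` times each neighbour, and this is
  -- pulled back to `x`.
  have main : ∀ x, X 1 x - X 0 x ≤ B * (1 + D) ^ 2 * (X 0 x - X (-1) x) ∧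
      X 1 x - X 0 x ≤ B * (1 + D) ^ 2 * (X 2 x - X 1 x) := by
    intro x
    obtain ⟨j, m, hj, h1, h2⟩ := hq.exists_orb_mem hE x (X (-1) z)
    rw [← hXm, hXX] at h1
    have hn := near _ h1.le h2
    have := pull j m 0 x D hD0 (by omega)
      (hn.trans (mul_le_mul_of_nonneg_left (by simpa using hz' (-1) (orb E j m x)) hD0))
      (hn.trans (mul_le_mul_of_nonneg_left (by simpa using hz' 1 (orb E j m x)) hD0))
    simpa using this
  intro x
  refine ⟨by simpa [hX0] using (main x).1, ?_⟩
  have := (main (X (-1) x)).2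
  rw [hXX, hXX, hXX] at this
  simpa [hX0] using this

/-! ### Reflection -/

/-- Conjugation by `x ↦ -x`. -/
def reflection : (ℝ ≃o ℝ) →* (ℝ ≃o ℝ) where
  toFun E :=
    { toEquiv := (Equiv.neg ℝ).trans (E.toEquiv.trans (Equiv.neg ℝ))
      map_rel_iff' := by intro a b; simp }
  map_one' := by ext x; exact neg_neg x
  map_mul' E E' := by ext x; change -E (E' (-x)) = -E (-(-E' (-x))); rw [neg_neg]

theorem reflection_apply (E : ℝ ≃o ℝ) (x : ℝ) : reflection E x = -E (-x) := rfl

theorem orb_reflection (E : ℝ ≃o ℝ) (i m : ℤ) (x : ℝ) :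
    orb (reflection E) i m x = -orb E i (-m) (-x) := by
  simp only [orb]
  rw [← map_zpow, reflection_apply]
  push_cast; ring

/-- Reflection changes the sign of the rotation number and turns returns from the left into returns
from the right, so that estimates are needed for one side only. -/
theorem IsRotationLike.reflect {E : ℝ ≃o ℝ} {ρ : ℝ} (hE : IsRotationLike E ρ) :
    IsRotationLike (reflection E) (-ρ) where
  irrational := hE.irrational.neg
  map_add_int x m := by
    rw [reflection_apply, reflection_apply]
    have := hE.map_add_int (-(x + m)) m
    rw [show -(x + m) + m = -x by ring] at this
    linarith
  lt_orb i m h x := by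
    rw [orb_reflection]
    have := hE.orb_lt_orb (i := i) (m := -m) (j := 0) (l := 0) (by push_cast; linarith) (-x)
    rw [orb_zero_zero] at this
    linarith

theorem schwarzian_reflect (F : ℝ → ℝ) (x : ℝ) :
    schwarzian (fun x => -F (-x)) x = schwarzian F (-x) := by
  have h1 : ∀ G : ℝ → ℝ, deriv (fun x => G (-x)) = fun x => -deriv G (-x) :=
    fun G => funext fun x => deriv_comp_neg G x
  have h2 : ∀ G : ℝ → ℝ, deriv (fun x => -G x) = fun x => -deriv G x :=
    fun G => funext fun x => deriv.fun_neg
  have e1 : deriv (fun x => -F (-x)) = fun x => deriv F (-x) := by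
    rw [h2 (fun x => F (-x)), h1]; simp
  have e2 : deriv (deriv (fun x => -F (-x))) = fun x => -deriv (deriv F) (-x) := by rw [e1, h1]
  obtain ⟨N, hN⟩ : ∃ N, N = fun s => deriv (deriv F) s / deriv F s := ⟨_, rfl⟩
  have e3 : (fun t => deriv (deriv (fun x => -F (-x))) t / deriv (fun x => -F (-x)) t) =
      fun t => -N (-t) := by
    rw [e2, e1, hN]; ext t; ring
  unfold schwarzian
  rw [e3, e2, e1, h2 (fun t => N (-t)), h1 N, ← hN]
  ring

theorem IsTameLift.reflect {F : ℝ → ℝ} (hF : IsTameLift F) : IsTameLift (fun x => -F (-x)) := by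
  have hd : deriv (fun x => -F (-x)) = fun x => deriv F (-x) :=
    funext fun x => (hasDerivAt_reflect hF.hasDerivAt x).deriv
  refine ⟨(hF.contDiff.comp contDiff_neg).neg, strictMono_reflect hF.strictMono, ?_, ?_, ?_⟩
  · intro x m
    have := hF.map_add_int (-(x + m)) m
    rw [show -(x + m) + m = -x by ring] at this
    linarith
  · rw [hd]
    refine (hF.finite.image (fun c => -c)).subset ?_
    rintro _ ⟨x, hx, rfl⟩
    refine ⟨((-x : ℝ) : Circle1), ⟨-x, hx, rfl⟩, ?_⟩
    simp
  · intro z hz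
    rw [hd] at hz
    obtain ⟨r, α, β, s, h⟩ := hF.powerLaw (-z) hz
    refine ⟨r, α, β, s, fun m => ?_⟩
    have e : -(-z + ((-m : ℤ) : ℝ)) = z + m := by push_cast; ring
    refine ⟨?_, fun x hx hne => ?_⟩
    · have := (h (-m)).1.reflect
      rwa [e, ← hd] at this
    · rw [schwarzian_reflect]
      refine (h (-m)).2 (-x) ?_ ?_
      · rw [← abs_neg]; convert hx using 2; push_cast; ring
      · intro h'; apply hne; rw [← e, ← h', neg_neg]

/-! ### Comparability at critical points -/

/-- At critical points of `E`, consecutive closest return intervals are comparable. -/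
theorem IsTameLift.exists_le_at_critical {E : ℝ ≃o ℝ} {ρ : ℝ} (hF : IsTameLift E)
    (hE : IsRotationLike E ρ) {C : ℝ} (hC : 1 ≤ C) :
    ∃ K, 0 < K ∧ ∀ {q q' : ℕ} {p p' : ℤ}, ClosestReturns ρ q q' p p' →
      (∀ x, orb E q (-p) x - x ≤ C * (x - orb E (-q) p x) ∧
        x - orb E (-q) p x ≤ C * (orb E q (-p) x - x)) →
      (∀ x, orb E (-q') p' x - x ≤ C * (x - orb E q' (-p') x)) →
      ∀ c, deriv E c = 0 → orb E q (-p) c - c ≤ K * (c - orb E q' (-p') c) := by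
  obtain ⟨B, hB, hcri⟩ := hF.exists_crossRatio_orb_le hE
  -- `κ` combines the cross-ratio constant `B` with the constant of the lower bound `low` for the
  -- cross-ratio after the return.
  obtain ⟨K, hK, hcomp⟩ := hF.exists_comparable
    (κ := 1 / (B * (C * (1 + C + C * C) * (1 + C)))) (by positivity)
  refine ⟨K, hK, ?_⟩
  intro q q' p p' hq hA hG c hc
  have hq0 := hq.pos
  have hqq := hq.le
  have t1 := hq.right
  have t2 := hq.left
  have t3 := hq.decreasing
  have t4 := hq.lt_one
  have c0 : c = orb E 0 0 c := (orb_zero_zero E c).symm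
  obtain ⟨R, hR⟩ : ∃ R, R = orb E q (-p) c := ⟨_, rfl⟩
  obtain ⟨g, hg⟩ : ∃ g, g = orb E q' (-p') c := ⟨_, rfl⟩
  obtain ⟨RR, hRR⟩ : ∃ x, x = orb E (2 * q) (-(2 * p)) c := ⟨_, rfl⟩
  have ogc : g < c := by
    have : g < orb E 0 0 c := by rw [hg]; exact hE.orb_lt_orb (by push_cast; linarith) c
    rwa [← c0] at this
  have ocR : c < R := by
    have : orb E 0 0 c < R := by rw [hR]; exact hE.orb_lt_orb (by push_cast; linarith) c
    rwa [← c0] at this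
  have oRR : R < RR := by
    rw [hR, hRR]; exact hE.orb_lt_orb (by push_cast; linarith) c
  rw [← hR, ← hg]
  have oR1 : R ≤ c + 1 := by
    have : R < orb E 0 1 c := by rw [hR]; exact hE.orb_lt_orb (by push_cast; linarith) c
    simpa [orb] using this.le
  have og1 : c - 1 ≤ g := by
    have : orb E 0 (-1) c < g := by rw [hg]; exact hE.orb_lt_orb (by push_cast; linarith) c
    have h2 : orb E 0 (-1) c = c - 1 := by simp [orb]; ring
    linarith
  refine hcomp c hc g R og1 ogc ocR oR1 ?_
  -- the cross-ratio of the images under `E` and under the first return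
  have hE1 : ∀ x, E x = orb E 1 0 x := fun x => by simp [orb]
  -- The passage through the critical point is split off: the cross-ratio inequality is used only
  -- for the remaining `q' - 1` iterates, starting at the critical value.
  obtain ⟨n, hn⟩ : ∃ n : ℕ, q' = n + 1 := ⟨q' - 1, by omega⟩
  have hret : ∀ x, orb E n (-p') (E x) = orb E q' (-p') x := by
    intro x
    rw [hE1, hE.orb_orb, hn]; push_cast; congr 1; ring
  have hmap := hcri hq (x := orb E (1 - q) p c) (a := E g) (b := E c) (c := E R) (d := E RR)
    (by rw [hE1, hg, hE.orb_orb]; exact hE.orb_le_orb (by push_cast; linarith) c)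
    (E.strictMono ogc) (E.strictMono ocR) (E.strictMono oRR)
    (by
      rw [hE1, hRR, hE.orb_orb, hE.orb_orb]
      exact le_of_eq (by congr 1 <;> ring)) n (by omega) (-p')
  rw [hret, hret, hret, hret] at hmap
  -- lower bound
  obtain ⟨g2, hg2⟩ : ∃ x, x = orb E q' (-p') g := ⟨_, rfl⟩
  obtain ⟨gR, hgR⟩ : ∃ x, x = orb E q' (-p') R := ⟨_, rfl⟩
  obtain ⟨gRR, hgRR⟩ : ∃ x, x = orb E q' (-p') RR := ⟨_, rfl⟩
  rw [← hg2, ← hg, ← hgR, ← hgRR] at hmap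
  have p1 : g2 < g := by
    rw [hg2]; nth_rewrite 2 [hg]; exact (orb_lt_orb_iff E).2 ogc
  have p2 : g < gR := by rw [hg, hgR]; exact (orb_lt_orb_iff E).2 ocR
  have p3 : gR < gRR := by rw [hgR, hgRR]; exact (orb_lt_orb_iff E).2 oRR
  have k1 : c - g ≤ C * (g - g2) := by
    have := hG g
    rw [← hg2] at this
    have e : orb E (-q') p' g = c := by
      rw [hg, hE.orb_orb, neg_add_cancel, add_neg_cancel, orb_zero_zero]
    rwa [e] at this
  have k2 : gR - g ≤ C * (gRR - gR) := by
    have := (hA gR).2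
    have e1 : orb E (-q) p gR = g := by
      rw [hgR, hR, hg, hE.orb_orb, hE.orb_orb]; congr 1 <;> ring
    have e2 : orb E q (-p) gR = gRR := by
      rw [hgR, hgRR, hR, hRR, hE.orb_orb, hE.orb_orb, hE.orb_orb]; congr 1 <;> ring
    rwa [e1, e2] at this
  -- The interval lies between the second return of `c` to the left, `orb E (-q + -q) (p + p) c`,
  -- and `R`; its hull consists of three adjacent return intervals, each comparable with `R - c`.
  have k3 : gR - g2 ≤ (1 + C + C * C) * (R - c) := by
    have h1 := (hA c).2
    have h2 := (hA (orb E (-q) p c)).2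
    rw [hE.orb_orb, hE.orb_orb, add_neg_cancel, neg_add_cancel, orb_zero_zero] at h2
    rw [← hR] at h1
    have h3 : orb E (-q + -q) (p + p) c < g2 := by
      rw [hg2, hg, hE.orb_orb]; exact hE.orb_lt_orb (by push_cast; linarith) c
    have h4 : gR < R := by
      rw [hgR, hR, hE.orb_orb]; exact hE.orb_lt_orb (by push_cast; linarith) c
    have h5 : C * (c - orb E (-q) p c) ≤ C * (C * (R - c)) := by gcongr
    linarith
  have low : (c - g) / (C * (1 + C + C * C) * (1 + C) * (R - c)) ≤ crossRatio g2 g gR gRR := by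
    unfold crossRatio
    have i1 : 0 < R - c := by linarith
    have i2 : 0 < gR - g2 := by linarith
    have i3 : 0 < gRR - g := by linarith
    have i4 : 0 < g - g2 := by linarith
    have i5 : 0 < gRR - gR := by linarith
    have i6 : 0 < c - g := by linarith
    rw [div_le_div_iff₀ (by positivity) (by positivity)]
    calc (c - g) * ((gR - g2) * (gRR - g)) ≤ (C * (g - g2)) *
          (((1 + C + C * C) * (R - c)) * ((1 + C) * (gRR - gR))) := by
          gcongr
          linarith
      _ = _ := by ring
  have high : crossRatio (E g) (E c) (E R) (E RR) ≤ (E c - E g) / (E R - E c) := by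
    have i1 := sub_pos.2 (E.strictMono ogc)
    have i2 := sub_pos.2 (E.strictMono ocR)
    have i3 := sub_pos.2 (E.strictMono oRR)
    have i4 : 0 < E RR - E c := by linarith
    unfold crossRatio
    rw [mul_div_mul_comm]
    calc _ ≤ (E c - E g) / (E R - E c) * 1 := by
          gcongr
          rw [div_le_one i4]; linarith
      _ = _ := mul_one _
  have fin := low.trans (hmap.trans (mul_le_mul_of_nonneg_left high (by linarith)))
  have i1 : 0 < R - c := by linarith
  have i2 := sub_pos.2 (E.strictMono ocR)
  rw [← mul_div_assoc, div_le_div_iff₀ (by positivity) i2] at fin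
  rw [one_div, mul_assoc, inv_mul_le_iff₀ (by positivity)]
  linarith

/-- **Real bounds at critical spots**, for closest returns from the right. -/
theorem IsTameLift.exists_le_of_critical_mem {E : ℝ ≃o ℝ} {ρ : ℝ} (hF : IsTameLift E)
    (hE : IsRotationLike E ρ) :
    ∃ K, 0 < K ∧ ∀ {q q' q'' : ℕ} {p p' p'' : ℤ}, ClosestReturns ρ q q' p p' →
      ClosestReturns (-ρ) q' q'' (-p') (-p'') → ∀ (c : ℝ) (k : ℕ),
      0 ≤ (q + (k + 1) * q') * ρ - (p + (k + 1) * p') →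
      ∀ y, orb E (q + (k + 1) * q') (-(p + (k + 1) * p')) c ≤ y →
      y ≤ orb E (q + k * q') (-(p + k * p')) c → (∃ i : ℕ, i < q' ∧ deriv E (orb E i 0 y) = 0) →
      orb E q (-p) c - c ≤ K * (orb E (q + k * q') (-(p + k * p')) c -
        orb E (q + (k + 1) * q') (-(p + (k + 1) * p')) c) := by
  obtain ⟨C₁, hC₁, hA₁⟩ := hF.exists_adjacent_le hE
  obtain ⟨C₂, hC₂, hA₂⟩ := IsTameLift.exists_adjacent_le (E := reflection E) hF.reflect hE.reflect
  obtain ⟨C, hC⟩ : ∃ C, C = max C₁ C₂ := ⟨_, rfl⟩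
  have hCC₁ : C₁ ≤ C := by rw [hC]; exact le_max_left _ _
  have hCC₂ : C₂ ≤ C := by rw [hC]; exact le_max_right _ _
  have hC1 : 1 ≤ C := hC₁.trans hCC₁
  obtain ⟨K₀, hK₀, hcrit⟩ := hF.exists_le_at_critical hE hC1
  obtain ⟨B, hB, hcri⟩ := hF.exists_crossRatio_orb_le hE
  -- `D` bounds the middle interval of the images by both neighbours: the summand `K₀ * (1 + C)`
  -- serves the right one (`n3`), the summand 1 the left one (`n4`).
  obtain ⟨D, hD⟩ : ∃ D, D = (C + C * C) * (K₀ * (1 + C) + 1) := ⟨_, rfl⟩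
  have hD0 : 0 ≤ D := by rw [hD]; positivity
  refine ⟨C * (B * (1 + D) ^ 2), by positivity, ?_⟩
  intro q q' q'' p p' p'' hq hq' c k hk y hy1 hy2 hi
  obtain ⟨i, hi, hci⟩ := hi
  have t1 := hq.right
  have t2 := hq.left
  have t3 := hq.decreasing
  have hA : ∀ x, orb E q (-p) x - x ≤ C * (x - orb E (-q) p x) ∧
      x - orb E (-q) p x ≤ C * (orb E q (-p) x - x) := by
    intro x
    have h0 : orb E 0 0 x < orb E q (-p) x := hE.orb_lt_orb (by push_cast; linarith) x
    have h1 : orb E (-q) p x < orb E 0 0 x := hE.orb_lt_orb (by push_cast; linarith) x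
    rw [orb_zero_zero] at h0 h1
    exact ⟨(hA₁ hq x).1.trans (mul_le_mul_of_nonneg_right hCC₁ (by linarith)),
      (hA₁ hq x).2.trans (mul_le_mul_of_nonneg_right hCC₁ (by linarith))⟩
  have hG : ∀ x, orb E (-q') p' x - x ≤ C * (x - orb E q' (-p') x) ∧
      x - orb E q' (-p') x ≤ C * (orb E (-q') p' x - x) := by
    intro x
    have h := hA₂ hq' (-x)
    simp only [orb_reflection, neg_neg] at h
    have h0 : orb E 0 0 x < orb E (-q') p' x := hE.orb_lt_orb (by push_cast; linarith) x
    have h1 : orb E q' (-p') x < orb E 0 0 x := hE.orb_lt_orb (by push_cast; linarith) x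
    rw [orb_zero_zero] at h0 h1
    constructor
    · have h2 : C₂ * (x - orb E q' (-p') x) ≤ C * (x - orb E q' (-p') x) :=
        mul_le_mul_of_nonneg_right hCC₂ (by linarith)
      linarith [h.2]
    · have h2 : C₂ * (orb E (-q') p' x - x) ≤ C * (orb E (-q') p' x - x) :=
        mul_le_mul_of_nonneg_right hCC₂ (by linarith)
      linarith [h.1]
  have hB1 := hcrit hq hA (fun x => (hG x).1) (orb E i 0 y) hci
  -- the four points
  obtain ⟨w, hw⟩ : ∃ w, w = orb E (q + k * q') (-(p + k * p')) c := ⟨_, rfl⟩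
  obtain ⟨v, hv⟩ : ∃ v, v = orb E (q + (k + 1) * q') (-(p + (k + 1) * p')) c := ⟨_, rfl⟩
  obtain ⟨b, hb⟩ : ∃ b, b = orb E (-q) p c := ⟨_, rfl⟩
  obtain ⟨a, ha⟩ : ∃ a, a = orb E (-q) p b := ⟨_, rfl⟩
  obtain ⟨R, hR⟩ : ∃ R, R = orb E q (-p) c := ⟨_, rfl⟩
  have hvw : v = orb E q' (-p') w := by
    rw [hv, hw, hE.orb_orb]; congr 1 <;> ring
  rw [← hv] at hy1
  rw [← hw] at hy2
  rw [← hv, ← hw, ← hR]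
  have ocv : c ≤ v := by
    have : orb E 0 0 c ≤ v := by rw [hv]; exact hE.orb_le_orb (by push_cast; linarith) c
    rwa [orb_zero_zero] at this
  have obc : b < c := by
    have : b < orb E 0 0 c := by rw [hb]; exact hE.orb_lt_orb (by push_cast; linarith) c
    rwa [orb_zero_zero] at this
  have oab : a < b := by
    rw [ha]; nth_rewrite 2 [hb]; rw [hb]; exact (orb_lt_orb_iff E).2 (by rw [← hb]; exact obc)
  have ovw : v < w := by
    rw [hv, hw]; exact hE.orb_lt_orb (by push_cast; linarith) c
  have owR : w ≤ R := by
    rw [hw, hR]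
    refine hE.orb_le_orb ?_ c
    have : (k : ℝ) * (q' * ρ - p') ≤ 0 := mul_nonpos_of_nonneg_of_nonpos (by positivity) t2.le
    push_cast; linarith
  have comm : ∀ (j l : ℤ) x, orb E i 0 (orb E j l x) = orb E j l (orb E i 0 x) := fun j l x => by
    rw [hE.orb_orb, hE.orb_orb]; congr 1 <;> ring
  -- the images under `E^i`
  obtain ⟨c', hc'⟩ : ∃ x, x = orb E i 0 c := ⟨_, rfl⟩
  obtain ⟨y', hy'⟩ : ∃ x, x = orb E i 0 y := ⟨_, rfl⟩
  obtain ⟨w', hw'⟩ : ∃ x, x = orb E i 0 w := ⟨_, rfl⟩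
  have eb : orb E i 0 b = orb E (-q) p c' := by rw [hb, comm, hc']
  have ea : orb E i 0 a = orb E (-q) p (orb E (-q) p c') := by rw [ha, comm, eb]
  have ev : orb E i 0 v = orb E q' (-p') w' := by rw [hvw, comm, hw']
  have eR : orb E i 0 R = orb E q (-p) c' := by rw [hR, comm, hc']
  have m1 : orb E q' (-p') w' ≤ y' := by
    rw [← ev, hy']; exact (orb_le_orb_iff E).2 hy1
  have m2 : y' ≤ w' := by rw [hy', hw']; exact (orb_le_orb_iff E).2 hy2
  have m3 : w' ≤ orb E q (-p) c' := by
    rw [← eR, hw']; exact (orb_le_orb_iff E).2 owR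
  have m4 : c' ≤ y' := by
    rw [hc', hy']; exact (orb_le_orb_iff E).2 (ocv.trans hy1)
  rw [← hy'] at hB1
  -- comparison of the three image intervals
  have n1 : y' - orb E q' (-p') y' ≤ (1 + C) * (w' - orb E q' (-p') w') := by
    have h1 := (hG (orb E q' (-p') w')).2
    have e : orb E (-q') p' (orb E q' (-p') w') = w' := by
      rw [hE.orb_orb, neg_add_cancel, add_neg_cancel, orb_zero_zero]
    rw [e] at h1
    have h2 : orb E q' (-p') (orb E q' (-p') w') ≤ orb E q' (-p') y' := (orb_le_orb_iff E).2 m1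
    linarith
  have h1 := (hA y').2
  have h2 := (hA (orb E (-q) p y')).2
  have e2 : ∀ x, orb E q (-p) (orb E (-q) p x) = x := fun x => by
    rw [hE.orb_orb, neg_add_cancel, add_neg_cancel, orb_zero_zero]
  have e3 : ∀ x, orb E (-q) p (orb E q (-p) x) = x := fun x => by
    rw [hE.orb_orb, neg_add_cancel, add_neg_cancel, orb_zero_zero]
  rw [e2] at h2
  have n2 : orb E (-q) p (orb E (-q) p y') ≤ orb E (-q) p c' := by
    refine (orb_le_orb_iff E).2 ?_
    have := (orb_le_orb_iff E (i := -q) (m := p)).2 (m2.trans m3)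
    rwa [e3] at this
  have pos1 : 0 < w' - orb E q' (-p') w' := by
    rw [← ev, hw']; exact sub_pos.2 ((orb_lt_orb_iff E).2 ovw)
  -- The middle interval lies between the second preimage of `y'` under the `q`-return and `y'`, so
  -- it is comparable with the `q`-return interval at `y'`; criticality of `y'` compares the latter
  -- with the image of Δ_k.
  have n3 : orb E q' (-p') w' - orb E (-q) p c' ≤ D * (w' - orb E q' (-p') w') := by
    have h3 : C * (y' - orb E (-q) p y') ≤ C * (C * (orb E q (-p) y' - y')) := by gcongr
    have h4 : y' - orb E (-q) p (orb E (-q) p y') ≤ (C + C * C) * (orb E q (-p) y' - y') := by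
      linarith
    calc _ ≤ (C + C * C) * (orb E q (-p) y' - y') := by linarith
      _ ≤ (C + C * C) * (K₀ * ((1 + C) * (w' - orb E q' (-p') w'))) := by
          gcongr
          refine hB1.trans ?_
          gcongr
      _ ≤ (C + C * C) * ((K₀ * (1 + C) + 1) * (w' - orb E q' (-p') w')) := by
          rw [← mul_assoc K₀]
          gcongr
          linarith
      _ = _ := by rw [hD]; ring
  have n4 : orb E q' (-p') w' - orb E (-q) p c' ≤
      D * (orb E (-q) p c' - orb E (-q) p (orb E (-q) p c')) := by
    have g1 := (hA c').1
    have g2 := (hA (orb E (-q) p c')).1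
    rw [e2] at g2
    have pos2 : 0 < orb E (-q) p c' - orb E (-q) p (orb E (-q) p c') := by
      rw [← ea, ← eb]; exact sub_pos.2 ((orb_lt_orb_iff E).2 oab)
    have h3 : C * (c' - orb E (-q) p c') ≤
        C * (C * (orb E (-q) p c' - orb E (-q) p (orb E (-q) p c'))) := by gcongr
    calc _ ≤ (C + C * C) * (orb E (-q) p c' - orb E (-q) p (orb E (-q) p c')) := by linarith
      _ ≤ _ := by
        gcongr
        rw [hD]
        refine le_mul_of_one_le_right (by positivity) ?_
        have : 0 ≤ K₀ * (1 + C) := by positivity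
        linarith
  have hpull := (sub_le_of_crossRatio_le oab (obc.trans_le ocv) ovw
    ((orb_lt_orb_iff E (i := i) (m := 0)).2 oab)
    ((orb_lt_orb_iff E (i := i) (m := 0)).2 (obc.trans_le ocv))
    ((orb_lt_orb_iff E (i := i) (m := 0)).2 ovw) hB hD0
    (hcri hq (x := a) le_rfl oab (obc.trans_le ocv) ovw (by
      refine owR.trans (le_of_eq ?_)
      rw [ha, hb, hR, hE.orb_orb, hE.orb_orb]; congr 1 <;> ring) i (by omega) 0)
    (by rw [ev, eb, ea]; exact n4) (by rw [ev, eb, ← hw']; exact n3)).2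
  have last := (hA c).1
  rw [← hR, ← hb] at last
  calc R - c ≤ C * (c - b) := last
    _ ≤ C * (v - b) := by gcongr
    _ ≤ C * (B * (1 + D) ^ 2 * (w - v)) := by gcongr
    _ = _ := by ring

/-! ### Continued fractions -/

/-- The iterates of the fractional part of `ρ` under the Gauss map. -/
noncomputable def gaussIter : ℝ → ℕ → ℝ
  | ρ, 0 => Int.fract ρ
  | ρ, n + 1 => gaussIter (Int.fract ρ)⁻¹ n

theorem gaussIter_succ (ρ : ℝ) (n : ℕ) : gaussIter ρ (n + 1) = Int.fract (gaussIter ρ n)⁻¹ := by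
  induction n generalizing ρ with
  | zero => rfl
  | succ n ih => exact ih (Int.fract ρ)⁻¹

theorem irrational_gaussIter {ρ : ℝ} (hρ : Irrational ρ) (n : ℕ) : Irrational (gaussIter ρ n) := by
  have hf : ∀ x : ℝ, Irrational x → Irrational (Int.fract x) := fun x hx => by
    rw [← Int.self_sub_floor]; exact hx.sub_intCast _
  induction n generalizing ρ with
  | zero => exact hf ρ hρ
  | succ n ih => exact ih (hf ρ hρ).inv

theorem gaussIter_pos {ρ : ℝ} (hρ : Irrational ρ) (n : ℕ) : 0 < gaussIter ρ n := by
  refine lt_of_le_of_ne ?_ (irrational_gaussIter hρ n).ne_zero.symm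
  cases n with
  | zero => exact Int.fract_nonneg _
  | succ n => rw [gaussIter_succ]; exact Int.fract_nonneg _

theorem gaussIter_lt_one (ρ : ℝ) (n : ℕ) : gaussIter ρ n < 1 := by
  cases n with
  | zero => exact Int.fract_lt_one _
  | succ n => rw [gaussIter_succ]; exact Int.fract_lt_one _

/-- The tail of the continued fraction of `ρ` is that of `(Int.fract ρ)⁻¹`, so the partial quotient
is the integer part of the inverse Gauss iterate; the fractional part is the next iterate. -/
theorem partialQuotient_eq {ρ : ℝ} (hρ : Irrational ρ) (n : ℕ) :
    (partialQuotient ρ n : ℝ) = (gaussIter ρ n)⁻¹ - gaussIter ρ (n + 1) := by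
  have h : (partialQuotient ρ n : ℤ) = ⌊(gaussIter ρ n)⁻¹⌋ := by
    induction n generalizing ρ with
    | zero =>
      have h0 : Int.fract ρ ≠ 0 := (irrational_gaussIter hρ 0).ne_zero
      have h1 := GenContFract.of_s_head h0
      have h2 : (GenContFract.of ρ).partDens.get? 0 = some ((⌊(Int.fract ρ)⁻¹⌋ : ℤ) : ℝ) :=
        GenContFract.partDen_eq_s_b (gp := ⟨1, _⟩) h1
      unfold partialQuotient
      rw [h2]
      simp only [Option.getD_some, gaussIter]
      rw [Int.natCast_floor_eq_floor, Int.floor_intCast]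
      exact_mod_cast Int.floor_nonneg.2 (inv_nonneg.2 (Int.fract_nonneg ρ))
    | succ n ih =>
      have hi : Irrational (Int.fract ρ)⁻¹ := (irrational_gaussIter hρ 0).inv
      have h1 : (GenContFract.of ρ).partDens.get? (n + 1) =
          (GenContFract.of (Int.fract ρ)⁻¹).partDens.get? n := by
        unfold GenContFract.partDens
        rw [Stream'.Seq.map_get?, Stream'.Seq.map_get?, GenContFract.of_s_succ]
      have := ih hi
      unfold partialQuotient at this ⊢
      rw [h1]
      exact this
  rw [gaussIter_succ, ← Int.self_sub_floor, sub_sub_cancel]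
  exact_mod_cast h

/-- The numerators of the convergents. -/
noncomputable def numerator (ρ : ℝ) : ℕ → ℤ
  | 0 => 0
  | 1 => 1
  | n + 2 => partialQuotient ρ (n + 1) * numerator ρ (n + 1) + numerator ρ n

/-- The signed distance `q n * ρ - p n`. -/
noncomputable def signedDist (ρ : ℝ) (n : ℕ) : ℝ := returnTime ρ n * ρ - numerator ρ n

theorem signedDist_add_two (ρ : ℝ) (n : ℕ) : signedDist ρ (n + 2) =
    partialQuotient ρ (n + 1) * signedDist ρ (n + 1) + signedDist ρ n := by
  simp only [signedDist, returnTime, numerator]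
  push_cast; ring

/-- Since the Gauss iterates lie in (0, 1), this yields at once that closest returns alternate in
side and shrink. -/
theorem signedDist_succ {ρ : ℝ} (hρ : Irrational ρ) (h0 : 0 < ρ) (h1 : ρ < 1) (n : ℕ) :
    signedDist ρ (n + 1) = -(signedDist ρ n * gaussIter ρ (n + 1)) := by
  induction n with
  | zero =>
    have e : gaussIter ρ 0 = ρ := Int.fract_eq_self.2 ⟨h0.le, h1⟩
    simp only [signedDist, returnTime, numerator, zero_add]
    rw [partialQuotient_eq hρ, e]
    push_cast
    field_simp
    ring
  | succ n ih =>
    rw [signedDist_add_two, partialQuotient_eq hρ]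
    have := (gaussIter_pos hρ (n + 1)).ne'
    have e : signedDist ρ n = -(signedDist ρ (n + 1) * (gaussIter ρ (n + 1))⁻¹) := by
      rw [ih]; field_simp
    rw [e]; ring

theorem signedDist_mul_succ_neg {ρ : ℝ} (hρ : Irrational ρ) (h0 : 0 < ρ) (h1 : ρ < 1) (n : ℕ) :
    signedDist ρ n ≠ 0 ∧ signedDist ρ n * signedDist ρ (n + 1) < 0 ∧
      |signedDist ρ (n + 1)| < |signedDist ρ n| ∧ |signedDist ρ n| < 1 := by
  induction n with
  | zero =>
    have e : signedDist ρ 0 = ρ := by simp [signedDist, returnTime, numerator]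
    have g0 := gaussIter_pos hρ 1
    have g1 := gaussIter_lt_one ρ 1
    have hs := signedDist_succ hρ h0 h1 0
    rw [zero_add] at hs ⊢
    rw [hs, e, abs_neg, abs_of_pos h0, abs_of_pos (by positivity)]
    refine ⟨h0.ne', ?_, by nlinarith, h1⟩
    have : 0 < ρ * (ρ * gaussIter ρ 1) := by positivity
    linarith
  | succ n ih =>
    have g0 := gaussIter_pos hρ (n + 2)
    have g1 := gaussIter_lt_one ρ (n + 2)
    have hs := signedDist_succ hρ h0 h1 (n + 1)
    have hne : signedDist ρ (n + 1) ≠ 0 := right_ne_zero_of_mul ih.2.1.ne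
    have hpos : 0 < |signedDist ρ (n + 1)| := abs_pos.2 hne
    refine ⟨hne, ?_, ?_, ih.2.2.1.trans ih.2.2.2⟩
    · rw [hs]
      have : 0 < signedDist ρ (n + 1) * signedDist ρ (n + 1) * gaussIter ρ (n + 2) :=
        mul_pos (mul_self_pos.2 hne) g0
      linarith
    · rw [hs, abs_neg, abs_mul, abs_of_pos g0]
      nlinarith

theorem returnTime_pos_le {ρ : ℝ} (hρ : Irrational ρ) (n : ℕ) :
    0 < returnTime ρ n ∧ returnTime ρ n ≤ returnTime ρ (n + 1) := by
  have hpq : ∀ n, 1 ≤ partialQuotient ρ n := by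
    intro n
    have h1 := partialQuotient_eq hρ n
    have h2 : 1 < (gaussIter ρ n)⁻¹ := (one_lt_inv₀ (gaussIter_pos hρ n)).2 (gaussIter_lt_one ρ n)
    have h3 := gaussIter_lt_one ρ (n + 1)
    have : (0 : ℝ) < partialQuotient ρ n := by linarith
    exact_mod_cast this
  induction n with
  | zero => exact ⟨one_pos, hpq 0⟩
  | succ n ih =>
    refine ⟨ih.1.trans_le ih.2, ?_⟩
    change _ ≤ partialQuotient ρ (n + 1) * returnTime ρ (n + 1) + returnTime ρ n
    have := Nat.le_mul_of_pos_left (returnTime ρ (n + 1)) (hpq (n + 1))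
    omega

/-- The determinant alternates between 1 and -1; squaring avoids keeping track of the sign. -/
theorem convergent_det (ρ : ℝ) (n : ℕ) :
    (returnTime ρ (n + 1) * numerator ρ n - returnTime ρ n * numerator ρ (n + 1) : ℤ) ^ 2 = 1 := by
  induction n with
  | zero => simp [returnTime, numerator]
  | succ n ih =>
    rw [← ih]
    simp only [returnTime, numerator]
    push_cast
    ring

/-- As the determinant is ±1, (l, -m) is an integer combination, with coefficients u and v, of the
two consecutive convergents. The bounds on `l` force u ≠ 0 and uv ≤ 0; the signed distances have
opposite signs, so the two contributions reinforce each other. -/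
theorem signedDist_best {ρ : ℝ} (hρ : Irrational ρ) (h0 : 0 < ρ) (h1 : ρ < 1) (n : ℕ) {l : ℕ}
    (hl : 0 < l) (hl' : l < returnTime ρ (n + 1)) (m : ℤ) : |signedDist ρ n| ≤ |l * ρ + m| := by
  have hdet := convergent_det ρ n
  have hq := returnTime_pos_le hρ n
  obtain ⟨d, hd⟩ : ∃ d : ℤ, d = returnTime ρ (n + 1) * numerator ρ n -
    returnTime ρ n * numerator ρ (n + 1) := ⟨_, rfl⟩
  rw [← hd] at hdet
  obtain ⟨u, hu⟩ : ∃ u : ℤ, u = -d * (l * numerator ρ (n + 1) + m * returnTime ρ (n + 1)) :=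
    ⟨_, rfl⟩
  obtain ⟨v, hv⟩ : ∃ v : ℤ, v = d * (returnTime ρ n * m + numerator ρ n * l) := ⟨_, rfl⟩
  have e1 : (l : ℤ) = u * returnTime ρ n + v * returnTime ρ (n + 1) := by
    rw [hu, hv]
    linear_combination (-(l : ℤ)) * hdet + d * l * hd
  have e2 : m = -(u * numerator ρ n + v * numerator ρ (n + 1)) := by
    rw [hu, hv]
    linear_combination (-m) * hdet + d * m * hd
  have e3 : l * ρ + m = u * signedDist ρ n + v * signedDist ρ (n + 1) := by
    have e1' : (l : ℝ) = u * returnTime ρ n + v * returnTime ρ (n + 1) := by exact_mod_cast e1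
    have e2' : (m : ℝ) = -(u * numerator ρ n + v * numerator ρ (n + 1)) := by exact_mod_cast e2
    rw [e1', e2']
    simp only [signedDist]
    ring
  obtain ⟨-, hneg, -, -⟩ := signedDist_mul_succ_neg hρ h0 h1 n
  have hq0 : (0 : ℤ) < returnTime ρ n := by exact_mod_cast hq.1
  have hl0 : (0 : ℤ) < l := by exact_mod_cast hl
  have hl1 : (l : ℤ) < returnTime ρ (n + 1) := by exact_mod_cast hl'
  have hu0 : u ≠ 0 := by
    rintro h
    rw [h, zero_mul, zero_add] at e1
    have hv1 : 0 < v := by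
      by_contra! hv0
      nlinarith
    nlinarith
  have huv : u * v ≤ 0 := by
    by_contra! hpos
    rcases pos_and_pos_or_neg_and_neg_of_mul_pos hpos with ⟨h2, h3⟩ | ⟨h2, h3⟩ <;> nlinarith
  have habs : (1 : ℝ) ≤ (u : ℝ) ^ 2 := by
    have : (1 : ℤ) ≤ u ^ 2 := by
      have := sq_nonneg u
      have := pow_ne_zero 2 hu0
      omega
    exact_mod_cast this
  have huv' : (u : ℝ) * v ≤ 0 := by exact_mod_cast huv
  rw [e3]
  apply sq_le_sq.1
  have h2 : 0 ≤ (u * v : ℝ) * (signedDist ρ n * signedDist ρ (n + 1)) :=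
    mul_nonneg_of_nonpos_of_nonpos huv' hneg.le
  have h3 := mul_le_mul_of_nonneg_right habs (sq_nonneg (signedDist ρ n))
  have h4 := sq_nonneg (v * signedDist ρ (n + 1))
  linarith

theorem closestReturns_of_pos {ρ : ℝ} (hρ : Irrational ρ) (h0 : 0 < ρ) (h1 : ρ < 1) {n : ℕ}
    (hn : 0 < signedDist ρ n) : ClosestReturns ρ (returnTime ρ n) (returnTime ρ (n + 1))
      (numerator ρ n) (numerator ρ (n + 1)) := by
  obtain ⟨-, h2, h3, h4⟩ := signedDist_mul_succ_neg hρ h0 h1 n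
  have h5 : signedDist ρ (n + 1) < 0 := by
    by_contra! h
    exact absurd (mul_nonneg hn.le h) (not_le.2 h2)
  rw [abs_of_pos hn] at h3 h4
  rw [abs_of_neg h5] at h3
  refine ⟨(returnTime_pos_le hρ n).1, (returnTime_pos_le hρ n).2, hn, h5, h3, h4,
    fun l hl hl' m => ?_⟩
  have := signedDist_best hρ h0 h1 n hl hl' m
  rwa [abs_of_pos hn] at this

theorem closestReturns_of_neg {ρ : ℝ} (hρ : Irrational ρ) (h0 : 0 < ρ) (h1 : ρ < 1) {n : ℕ}
    (hn : signedDist ρ n < 0) : ClosestReturns (-ρ) (returnTime ρ n) (returnTime ρ (n + 1))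
      (-numerator ρ n) (-numerator ρ (n + 1)) := by
  obtain ⟨-, h2, h3, h4⟩ := signedDist_mul_succ_neg hρ h0 h1 n
  have h5 : 0 < signedDist ρ (n + 1) := by
    by_contra! h
    exact absurd (mul_nonneg_of_nonpos_of_nonpos hn.le h) (not_le.2 h2)
  rw [abs_of_neg hn] at h3 h4
  rw [abs_of_pos h5] at h3
  have e : ∀ n, returnTime ρ n * -ρ - ((-numerator ρ n : ℤ) : ℝ) = -signedDist ρ n := fun n => by
    simp only [signedDist]; push_cast; ring
  refine ⟨(returnTime_pos_le hρ n).1, (returnTime_pos_le hρ n).2, ?_, ?_, ?_, ?_,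
    fun l hl hl' m => ?_⟩
  · rw [e]; linarith
  · rw [e]; linarith
  · rw [e, e]; linarith
  · rw [e]; linarith
  · have := signedDist_best hρ h0 h1 n hl hl' (-m)
    rw [abs_of_neg hn] at this
    rw [e, ← abs_neg]
    convert this using 2
    push_cast; ring

/-! ### Real bounds for the lift -/

/-- The sign of the signed distance decides whether the one-sided bound is used for `E` or for its
reflection; absolute values merge the two cases. -/
theorem IsTameLift.exists_abs_le_of_critical_mem {E : ℝ ≃o ℝ} {ρ : ℝ} (hF : IsTameLift E)
    (hE : IsRotationLike E ρ) (h0 : 0 < ρ) (h1 : ρ < 1) :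
    ∃ K, 0 < K ∧ ∀ n k : ℕ, k < partialQuotient ρ (n + 1) → ∀ c y A D : ℝ,
      A = orb E (returnTime ρ n + (k + 1) * returnTime ρ (n + 1))
        (-(numerator ρ n + (k + 1) * numerator ρ (n + 1))) c →
      D = orb E (returnTime ρ n + k * returnTime ρ (n + 1))
        (-(numerator ρ n + k * numerator ρ (n + 1))) c →
      |D - A| ≤ |orb E (returnTime ρ n) (-numerator ρ n) c - c| ∧
      (y ∈ Set.uIcc A D →
      (∃ i : ℕ, i < returnTime ρ (n + 1) ∧ deriv E (orb E i 0 y) = 0) →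
      |orb E (returnTime ρ n) (-numerator ρ n) c - c| ≤ K * |D - A|) := by
  have hρ := hE.irrational
  obtain ⟨K₁, hK₁, hb₁⟩ := hF.exists_le_of_critical_mem hE
  obtain ⟨K₂, hK₂, hb₂⟩ :=
    IsTameLift.exists_le_of_critical_mem (E := reflection E) hF.reflect hE.reflect
  refine ⟨max K₁ K₂, lt_max_of_lt_left hK₁, ?_⟩
  intro n k hk c y A D hA hD
  obtain ⟨hne, hneg, -, -⟩ := signedDist_mul_succ_neg hρ h0 h1 n
  have hs := signedDist_succ hρ h0 h1 n
  -- This is where `k < a (n + 1)` enters: after `k + 1` short returns the orbit has not crossed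
  -- `c`, so `A` and `D` lie between `c` and its `q n`-th return.
  have hk' : ((k : ℝ) + 1) * gaussIter ρ (n + 1) ≤ 1 := by
    have h2 := partialQuotient_eq hρ (n + 1)
    have h3 : ((k : ℝ) + 1) ≤ partialQuotient ρ (n + 1) := by exact_mod_cast hk
    have h4 := gaussIter_pos hρ (n + 2)
    have h5 := gaussIter_pos hρ (n + 1)
    calc ((k : ℝ) + 1) * gaussIter ρ (n + 1) ≤ (gaussIter ρ (n + 1))⁻¹ * gaussIter ρ (n + 1) := by
          gcongr; linarith
      _ = 1 := inv_mul_cancel₀ h5.ne'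
  have hexp : ∀ t : ℝ, (returnTime ρ n + t * returnTime ρ (n + 1)) * ρ -
      (numerator ρ n + t * numerator ρ (n + 1)) = signedDist ρ n + t * signedDist ρ (n + 1) := by
    intro t; simp only [signedDist]; ring
  have hk0 : (0 : ℝ) ≤ k := Nat.cast_nonneg k
  have horb : ∀ i m : ℤ, 0 ≤ i * ρ + m → c ≤ orb E i m c := fun i m h => by
    have := hE.orb_le_orb (i := 0) (m := 0) (j := i) (l := m) (by push_cast; linarith) c
    rwa [orb_zero_zero] at this
  have horb' : ∀ i m : ℤ, i * ρ + m ≤ 0 → orb E i m c ≤ c := fun i m h => by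
    have := hE.orb_le_orb (j := 0) (l := 0) (i := i) (m := m) (by push_cast; linarith) c
    rwa [orb_zero_zero] at this
  have e1 := hexp (k + 1)
  have e2 := hexp k
  have e0 : returnTime ρ n * ρ - numerator ρ n = signedDist ρ n := rfl
  have hmul : signedDist ρ n + ((k : ℝ) + 1) * signedDist ρ (n + 1) =
      signedDist ρ n * (1 - (k + 1) * gaussIter ρ (n + 1)) := by rw [hs]; ring
  rcases lt_or_gt_of_ne hne with hn | hn
  · have hn1 : 0 < signedDist ρ (n + 1) := pos_of_mul_neg_right hneg hn.le
    have hkn : 0 ≤ (k : ℝ) * signedDist ρ (n + 1) := by positivity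
    have hle : signedDist ρ n + ((k : ℝ) + 1) * signedDist ρ (n + 1) ≤ 0 := by
      rw [hmul]; exact mul_nonpos_of_nonpos_of_nonneg hn.le (by linarith)
    have o1 : orb E (returnTime ρ n) (-numerator ρ n) c ≤ D := by
      rw [hD]; exact hE.orb_le_orb (by push_cast; linarith) c
    have o2 : D < A := by
      rw [hA, hD]; exact hE.orb_lt_orb (by push_cast; linarith) c
    have o3 : A ≤ c := by
      rw [hA]; exact horb' _ _ (by push_cast; linarith)
    rw [abs_of_neg (show D - A < 0 by linarith),
      abs_of_nonpos (show orb E (returnTime ρ n) (-numerator ρ n) c - c ≤ 0 by linarith)]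
    refine ⟨by linarith, fun hy hi => ?_⟩
    obtain ⟨i, hi, hci⟩ := hi
    rw [Set.uIcc_of_ge o2.le] at hy
    have hn' := closestReturns_of_pos hρ h0 h1 hn1
    have eA : ∀ m, m = -(numerator ρ n + (k + 1) * numerator ρ (n + 1)) →
        orb E (returnTime ρ n + (k + 1) * returnTime ρ (n + 1)) m c = A := by
      rintro m rfl; rw [hA]
    have eD : ∀ m, m = -(numerator ρ n + k * numerator ρ (n + 1)) →
        orb E (returnTime ρ n + k * returnTime ρ (n + 1)) m c = D := by
      rintro m rfl; rw [hD]
    have hd : deriv (reflection E) = fun x => deriv E (-x) :=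
      funext fun x => (hasDerivAt_reflect hF.hasDerivAt x).deriv
    have hr := hb₂ (closestReturns_of_neg hρ h0 h1 hn) (q'' := returnTime ρ (n + 2))
      (p'' := -numerator ρ (n + 2)) (by simpa using hn') (-c) k
      (by push_cast; linarith) (-y)
      (by rw [orb_reflection, neg_neg c, eA _ (by ring)]; exact neg_le_neg hy.2)
      (by rw [orb_reflection, neg_neg c, eD _ (by ring)]; exact neg_le_neg hy.1)
      ⟨i, hi, by
        rw [hd]
        change deriv E (-orb (reflection E) i 0 (-y)) = 0
        rw [orb_reflection, neg_neg, neg_neg]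
        simpa using hci⟩
    rw [orb_reflection, orb_reflection, orb_reflection, neg_neg c, neg_neg (numerator ρ n),
      eA _ (by ring),
      eD _ (by ring)] at hr
    calc _ = -orb E (returnTime ρ n) (-numerator ρ n) c - -c := by ring
      _ ≤ K₂ * (-D - -A) := hr
      _ = K₂ * -(D - A) := by ring
      _ ≤ _ := mul_le_mul_of_nonneg_right (le_max_right _ _) (by linarith)
  · have hn1 : signedDist ρ (n + 1) < 0 := neg_of_mul_neg_right hneg hn.le
    have hkn : (k : ℝ) * signedDist ρ (n + 1) ≤ 0 := mul_nonpos_of_nonneg_of_nonpos hk0 hn1.le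
    have hle : 0 ≤ signedDist ρ n + ((k : ℝ) + 1) * signedDist ρ (n + 1) := by
      rw [hmul]; exact mul_nonneg hn.le (by linarith)
    have o1 : D ≤ orb E (returnTime ρ n) (-numerator ρ n) c := by
      rw [hD]; exact hE.orb_le_orb (by push_cast; linarith) c
    have o2 : A < D := by
      rw [hA, hD]; exact hE.orb_lt_orb (by push_cast; linarith) c
    have o3 : c ≤ A := by
      rw [hA]; exact horb _ _ (by push_cast; linarith)
    rw [abs_of_pos (show 0 < D - A by linarith),
      abs_of_nonneg (show 0 ≤ orb E (returnTime ρ n) (-numerator ρ n) c - c by linarith)]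
    refine ⟨by linarith, fun hy hi => ?_⟩
    rw [Set.uIcc_of_le o2.le] at hy
    have hr := hb₁ (closestReturns_of_pos hρ h0 h1 hn) (closestReturns_of_neg hρ h0 h1 hn1) c k
      (by linarith) y (by rw [← hA]; exact hy.1) (by rw [← hD]; exact hy.2) hi
    rw [← hA, ← hD] at hr
    exact hr.trans (mul_le_mul_of_nonneg_right (le_max_left _ _) (by linarith))

/-! ### Arcs -/

theorem cIcc_coe {a b : ℝ} (hab : a < b) (hb : b < a + 1) :
    Set.cIcc (a : Circle1) b = (fun x : ℝ => (x : Circle1)) '' Set.Icc a b := by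
  have key : ∀ t ∈ Set.Ico a (a + 1), (btw (a : Circle1) (t : Circle1) (b : Circle1) ↔ t ≤ b) := by
    intro t ht
    rw [QuotientAddGroup.btw_coe_iff, (toIcoMod_eq_self _).2 ht,
      (toIocMod_eq_self _).2 ⟨hab, hb.le⟩]
  ext x
  constructor
  · intro hx
    obtain ⟨t, ht, rfl⟩ : ∃ t ∈ Set.Ico a (a + 1), (t : Circle1) = x :=
      ⟨_, (AddCircle.equivIco (1 : ℝ) a x).2, (AddCircle.equivIco (1 : ℝ) a).symm_apply_apply x⟩
    exact ⟨t, ⟨ht.1, (key t ht).1 hx⟩, rfl⟩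
  · rintro ⟨t, ht, rfl⟩
    exact (key t ⟨ht.1, by linarith [ht.2]⟩).2 ht.2

theorem arcLength_image_uIcc {a b : ℝ} (h : |b - a| < 1) :
    arcLength ((fun x : ℝ => (x : Circle1)) '' Set.uIcc a b) = |b - a| := by
  have h' := abs_lt.1 h
  have hsub : Set.uIcc a b ⊆ Set.Ioc (max a b - 1) (max a b - 1 + 1) := by
    intro x hx
    have : max a b - 1 < min a b := by
      rcases le_total a b with h2 | h2
      · rw [max_eq_right h2, min_eq_left h2]; linarith
      · rw [max_eq_left h2, min_eq_right h2]; linarith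
    exact ⟨this.trans_le hx.1, by rw [sub_add_cancel]; exact hx.2⟩
  rw [arcLength, Measure.real, volume_image_coe measurableSet_uIcc hsub, Set.uIcc, Real.volume_Icc,
    max_sub_min_eq_abs, ENNReal.toReal_ofReal (abs_nonneg _)]

theorem orb_image_uIcc (E : ℝ ≃o ℝ) (i m : ℤ) (a b : ℝ) :
    orb E i m '' Set.uIcc a b = Set.uIcc (orb E i m a) (orb E i m b) := by
  have h : ∀ a b, a ≤ b → orb E i m '' Set.Icc a b = Set.Icc (orb E i m a) (orb E i m b) := by
    intro a b _
    have : orb E i m = ((E ^ i).trans (OrderIso.addRight (m : ℝ))) := rfl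
    rw [this]
    exact OrderIso.image_Icc _ a b
  rcases le_total a b with hab | hab
  · rw [Set.uIcc_of_le hab, Set.uIcc_of_le ((orb_le_orb_iff E).2 hab), h a b hab]
  · rw [Set.uIcc_of_ge hab, Set.uIcc_of_ge ((orb_le_orb_iff E).2 hab), h b a hab]

/-! ### From the circle to the line -/

theorem IsLift.exists_eq_add_int {G H : ℝ → ℝ} {g : Circle1 → Circle1} (hG : IsLift G g)
    (hH : IsLift H g) : ∃ k : ℤ, ∀ x, H x = G x + k := by
  have hint : ∀ x, ∃ k : ℤ, H x = G x + k := fun x =>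
    coe_eq_coe_iff_exists_int.1 ((hH.2 x).trans (hG.2 x).symm)
  choose k hk using hint
  have hc : Continuous k := by
    rw [Int.isClosedEmbedding_coe_real.isInducing.continuous_iff]
    have : ((↑) : ℤ → ℝ) ∘ k = fun x => H x - G x := funext fun x => by
      simp only [Function.comp_apply]; linarith [hk x]
    rw [this]
    exact hH.1.sub hG.1
  refine ⟨k 0, fun x => ?_⟩
  have hx : k x = k 0 := PreconnectedSpace.constant inferInstance hc
  rw [← hx]
  exact hk x

theorem IsLift.iterate {G : ℝ → ℝ} {g : Circle1 → Circle1} (hG : IsLift G g) (n : ℕ) :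
    IsLift G^[n] g^[n] := by
  refine ⟨hG.1.iterate n, fun x => ?_⟩
  induction n generalizing x with
  | zero => rfl
  | succ n ih => rw [Function.iterate_succ_apply, Function.iterate_succ_apply, ih, hG.2]

theorem IsTameLift.exists_deriv_eq_zero_of_iterate {F : ℝ → ℝ} (hF : IsTameLift F) {n : ℕ} {x : ℝ}
    (h : HasDerivAt F^[n] 0 x) : ∃ i < n, deriv F (F^[i] x) = 0 := by
  induction n with
  | zero =>
    exact absurd ((hasDerivAt_id x).unique h) one_ne_zero
  | succ n ih =>
    have hd : DifferentiableAt ℝ F^[n] x :=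
      ((hF.contDiff.differentiable (by norm_num)).iterate n) x
    rw [Function.iterate_succ'] at h
    have h2 := ((hF.hasDerivAt (F^[n] x)).comp x hd.hasDerivAt).unique h
    rcases mul_eq_zero.1 h2 with h3 | h3
    · exact ⟨n, Nat.lt_succ_self n, h3⟩
    · obtain ⟨i, hi, e⟩ := ih (h3 ▸ hd.hasDerivAt)
      exact ⟨i, hi.trans (Nat.lt_succ_self n), e⟩

theorem IsTameLift.exists_of_isCriticalPt_iterate {E : ℝ ≃o ℝ} {f : Circle1 → Circle1}
    (hF : IsTameLift E) (hL : IsLift E f) {n : ℕ} {y : ℝ} (h : IsCriticalPt f^[n] (y : Circle1)) :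
    ∃ i < n, deriv E (orb E i 0 y) = 0 := by
  obtain ⟨G, hG, x, hx, hd⟩ := h
  obtain ⟨k, hk⟩ := hG.exists_eq_add_int (hL.iterate n)
  have hd' : HasDerivAt E^[n] 0 x := by
    have : E^[n] = fun x => G x + k := funext hk
    rw [this]
    exact hd.add_const _
  obtain ⟨i, hi, e⟩ := hF.exists_deriv_eq_zero_of_iterate hd'
  refine ⟨i, hi, ?_⟩
  obtain ⟨m, rfl⟩ := coe_eq_coe_iff_exists_int.1 hx
  rw [orb_natCast_zero]
  have hit : ∀ (j : ℕ) (z : ℝ), E^[j] (z + m) = E^[j] z + m := fun j => by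
    induction j with
    | zero => exact fun z => rfl
    | succ j ih => intro z; rw [Function.iterate_succ_apply, hF.map_add_int, ih]; rfl
  rwa [hit, hF.deriv_add_int] at e

/-- If the translation number is rational, the iterate of order its denominator has an integer
translation number, hence moves some point by exactly that integer; this point projects to a
periodic one. -/
theorem irrational_translationNumber {f : Circle1 ≃ₜ Circle1} {F : CircleDeg1Lift}
    (hL : IsLift F f) (hper : Function.periodicPts f = ∅) :
    Irrational (CircleDeg1Lift.translationNumber F) := by
  rintro ⟨r, hr⟩
  have h1 : CircleDeg1Lift.translationNumber (F ^ r.den) = (r.num : ℤ) := by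
    rw [CircleDeg1Lift.translationNumber_pow, ← hr]
    have : (r.den : ℚ) * r = r.num := Rat.den_mul_eq_num r
    exact_mod_cast this
  obtain ⟨x, hx⟩ := ((F ^ r.den).translationNumber_eq_int_iff
    (by rw [CircleDeg1Lift.coe_pow]; exact hL.1.iterate _)).1 h1
  rw [CircleDeg1Lift.coe_pow] at hx
  have h2 := (hL.iterate r.den).2 x
  rw [coe_eq_coe_iff_exists_int.2 ⟨_, hx⟩] at h2
  have : (x : Circle1) ∈ Function.periodicPts f := ⟨r.den, r.den_pos, h2.symm⟩
  rw [hper] at this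
  exact this

/-- If the translation number of G^n differs from an integer, G^n displaces every point on the same
side of that integer. Negative exponents follow by applying this at the preimage. -/
theorem isRotationLike_of_lift {E : ℝ ≃o ℝ} {G : CircleDeg1Lift} (hEG : ⇑E = ⇑G)
    (hρ : Irrational (CircleDeg1Lift.translationNumber G)) :
    IsRotationLike E (CircleDeg1Lift.translationNumber G) := by
  refine ⟨hρ, fun x m => by rw [hEG]; exact G.map_add_int x m, ?_⟩
  have hpow : ∀ (n : ℕ) (x : ℝ), (E ^ n) x = (G ^ n) x := by
    intro n x
    have := orb_natCast_zero E n x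
    rw [hEG] at this
    rw [CircleDeg1Lift.coe_pow, ← this]
    simp [orb]
  intro i m h x
  obtain ⟨n, rfl | rfl⟩ := i.eq_nat_or_neg
  · have := (G ^ n).lt_map_of_int_lt_translationNumber (n := -m) (by
      rw [CircleDeg1Lift.translationNumber_pow]; push_cast at h ⊢; linarith) x
    rw [← hpow] at this
    simp only [orb, zpow_natCast]
    push_cast at this
    linarith
  · have := (G ^ n).map_lt_of_translationNumber_lt_int (n := m) (by
      rw [CircleDeg1Lift.translationNumber_pow]; push_cast at h; linarith) ((E ^ (-(n : ℤ))) x)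
    rw [← hpow] at this
    have e : (E ^ n) ((E ^ (-(n : ℤ))) x) = x := by
      rw [← RelIso.mul_apply, ← zpow_natCast, ← zpow_add, add_neg_cancel, zpow_zero]; rfl
    rw [e] at this
    exact this

theorem dist_coe_of_lt {x z : ℝ} (h : |x - z| < 1 / 2) :
    dist (x : Circle1) (z : Circle1) = |x - z| := by
  rw [dist_eq_norm, ← AddCircle.coe_sub, UnitAddCircle.norm_eq, round_eq_zero_iff.2]
  · simp
  · have := abs_lt.1 h
    exact ⟨by linarith, by linarith⟩

theorem IsMulticritical.exists_lift {f : Circle1 ≃ₜ Circle1} (hf : IsMulticritical f) :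
    ∃ (E : ℝ ≃o ℝ) (G : CircleDeg1Lift), ⇑E = ⇑G ∧ IsLift E f ∧ IsTameLift E ∧
      CircleDeg1Lift.translationNumber G = rotationNumber f := by
  obtain ⟨F, hL, hF, hfin, W, hW, -⟩ := hf
  -- The lift is shifted by an integer so that its translation number is the rotation number itself,
  -- in `[0, 1)`.
  set N := ⌊CircleDeg1Lift.translationNumber F⌋ with hN
  set T : CircleDeg1Lift :=
    (CircleDeg1Lift.translate (Multiplicative.ofAdd (((-N : ℤ) : ℝ))) : CircleDeg1Lift) with hT
  set G := T * F with hG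
  have hGF : ⇑G = fun x => F x + ((-N : ℤ) : ℝ) := by
    ext x
    simp [hG, hT, add_comm]
  have hτ : CircleDeg1Lift.translationNumber G = rotationNumber f := by
    rw [rotationNumber_eq f F hL, hG, CircleDeg1Lift.translationNumber_mul_of_commute,
      hT, CircleDeg1Lift.translationNumber_translate, ← Int.self_sub_floor]
    · push_cast; ring
    · ext x
      simp only [CircleDeg1Lift.mul_apply, hT, CircleDeg1Lift.translate_apply]
      rw [F.map_int_add]
  have hGL : IsLift G f := by
    rw [hGF]
    refine ⟨hL.1.add continuous_const, fun x => ?_⟩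
    rw [← hL.2 x]
    exact coe_eq_coe_iff_exists_int.2 ⟨-N, rfl⟩
  have hinj : Function.Injective G := by
    intro x y hxy
    have h1 : f (x : Circle1) = f (y : Circle1) := by rw [← hGL.2, ← hGL.2, hxy]
    obtain ⟨m, rfl⟩ := coe_eq_coe_iff_exists_int.1 (f.injective h1)
    rw [G.map_add_int] at hxy
    linarith
  have hmono : StrictMono G := G.strictMono_iff_injective.2 hinj
  have hsurj : Function.Surjective G := hGL.1.surjective G.tendsto_atTop G.tendsto_atBot
  have hd : deriv G = deriv F := by
    rw [hGF]; ext x; exact deriv_add_const _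
  have hS : schwarzian G = schwarzian F := by
    ext x; unfold schwarzian; rw [hd]
  have hC : ContDiff ℝ 3 G := by rw [hGF]; exact hF.add contDiff_const
  have hcrit : ∀ z : ℝ, deriv G z = 0 → IsCriticalPt f (z : Circle1) := fun z hz =>
    ⟨G, hGL, z, rfl, hz ▸ (hC.differentiable (by norm_num) z).hasDerivAt⟩
  suffices hGT : IsTameLift G from
    ⟨hmono.orderIsoOfSurjective G hsurj, G, rfl, hGL, hGT, hτ⟩
  refine ⟨hC, hmono, G.map_add_int, ?_, ?_⟩
  · refine hfin.subset ?_
    rintro _ ⟨z, hz, rfl⟩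
    exact hcrit z hz
  · intro z hz
    obtain ⟨hnhds, hneg, α, β, s, hα, hαβ, hs, hpow⟩ := hW z (hcrit z hz)
    obtain ⟨r, hr, hball⟩ := Metric.mem_nhds_iff.1 hnhds
    -- Below distance 1/2 the circle metric agrees with the absolute value on the line.
    refine ⟨min r (1 / 2), α, β, s, fun m => ?_⟩
    have hz' : ((z + m : ℝ) : Circle1) = z := coe_eq_coe_iff_exists_int.2 ⟨m, rfl⟩
    have hx : ∀ x : ℝ, |x - (z + m)| < min r (1 / 2) →
        dist (x : Circle1) (z : Circle1) = |x - (z + m)| ∧ (x : Circle1) ∈ W z := by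
      intro x hx
      have h1 := dist_coe_of_lt (hx.trans_le (min_le_right _ _))
      rw [hz'] at h1
      refine ⟨h1, hball ?_⟩
      rw [Metric.mem_ball, h1]
      exact hx.trans_le (min_le_left _ _)
    have hne : ∀ x : ℝ, |x - (z + m)| < min r (1 / 2) → x ≠ z + m → (x : Circle1) ≠ z := by
      intro x hx1 hx2 he
      have := (hx x hx1).1
      rw [he, dist_self] at this
      exact hx2 (sub_eq_zero.1 (abs_eq_zero.1 this.symm))
    refine ⟨⟨lt_min hr (by norm_num), hα, hα.trans hαβ, hs, fun x hx1 => ?_⟩, fun x hx1 hx2 => ?_⟩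
    · by_cases hxz : x = z + m
      · rw [hxz, sub_self, abs_zero, Real.zero_rpow (by linarith), mul_zero, mul_zero]
        have : deriv G (z + m) = 0 := by
          have hp : (fun x => F (x + m)) = fun x => F x + m := funext fun x => F.map_add_int x m
          have : deriv (fun x => F (x + m)) z = deriv F z := by rw [hp]; exact deriv_add_const _
          rw [deriv_comp_add_const] at this
          rw [hd] at hz ⊢
          rw [this, hz]
        exact ⟨this.ge, this.le⟩
      · have := hpow x (hx x hx1).2 (hne x hx1 hxz)
        rw [(hx x hx1).1, ← hd] at this
        exact ⟨this.1.le, this.2.le⟩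
    · rw [hS]
      exact hneg x (hx x hx1).2 (hne x hx1 hx2)

theorem IsLift.iterate_coe {E : ℝ ≃o ℝ} {f : Circle1 → Circle1} (hL : IsLift E f) (n : ℕ)
    (m : ℤ) (x : ℝ) : f^[n] (x : Circle1) = (orb E n m x : Circle1) := by
  rw [← (hL.iterate n).2 x, ← orb_natCast_zero]
  exact coe_eq_coe_iff_exists_int.2 ⟨-m, by simp [orb]⟩

/-- The signed distances of indices `n` and `n + 2` have the same sign and the second is smaller in
absolute value, so the arc singled out by the return of order `q (n + 2)` lifts to the interval from
`x` to its nearest return of order `q n`. -/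
theorem I_coe {E : ℝ ≃o ℝ} {f : Circle1 ≃ₜ Circle1} (hL : IsLift E f)
    (hE : IsRotationLike E (rotationNumber f)) (h0 : 0 < rotationNumber f)
    (h1 : rotationNumber f < 1) (n : ℕ) (x : ℝ) :
    I f n (x : Circle1) = (fun x : ℝ => (x : Circle1)) ''
      Set.uIcc x (orb E (q f n) (-numerator (rotationNumber f) n) x) := by
  have hρ := hE.irrational
  set ρ := rotationNumber f with hρ'
  obtain ⟨p, hp⟩ : ∃ p, p = numerator ρ n := ⟨_, rfl⟩
  obtain ⟨p₂, hp₂⟩ : ∃ p, p = numerator ρ (n + 2) := ⟨_, rfl⟩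
  have e : (q f n : ℝ) * ρ - p = signedDist ρ n := by rw [hp]; rfl
  have e₂ : (q f (n + 2) : ℝ) * ρ - p₂ = signedDist ρ (n + 2) := by rw [hp₂]; rfl
  obtain ⟨hne, hneg, hlt, hlt1⟩ := signedDist_mul_succ_neg hρ h0 h1 n
  obtain ⟨-, hneg', hlt', -⟩ := signedDist_mul_succ_neg hρ h0 h1 (n + 1)
  have hlt2 := hlt'.trans hlt
  rw [← hp]
  have horb : ∀ {i m : ℤ}, 0 < i * ρ + m → x < orb E i m x := fun h => hE.lt_orb _ _ h x
  have horb' : ∀ {i m : ℤ}, i * ρ + m < 0 → orb E i m x < x := fun {i m} h => by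
    have := hE.orb_lt_orb (j := 0) (l := 0) (i := i) (m := m) (by push_cast; linarith) x
    rwa [orb_zero_zero] at this
  have hone : ∀ (i m : ℤ), orb E i (m + 1) x = orb E i m x + 1 := fun i m => by
    simp only [orb]; push_cast; ring
  unfold I
  rcases lt_or_gt_of_ne hne with hn | hn
  · have hn1 : 0 < signedDist ρ (n + 1) := pos_of_mul_neg_right hneg hn.le
    have hn2 : signedDist ρ (n + 2) < 0 := neg_of_mul_neg_right hneg' hn1.le
    rw [abs_of_neg hn2, abs_of_neg hn] at hlt2
    rw [abs_of_neg hn] at hlt1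
    have o1 : orb E (q f n) (-p) x < x := horb' (by push_cast; linarith)
    have o2 : x < orb E (q f n) (-p + 1) x := horb (by push_cast; linarith)
    rw [if_neg, IsLift.iterate_coe hL (q f n) (-p), cIcc_coe o1, Set.uIcc_of_ge o1.le]
    · rw [← hone]; exact o2
    · rw [IsLift.iterate_coe hL (q f n) (-p + 1),
        IsLift.iterate_coe hL (q f (n + 2)) (-p₂), cIcc_coe o2 (by rw [hone]; linarith)]
      -- A point of the complementary arc would be a translate by an integer strictly between 0 and
      -- 1.
      rintro ⟨t, ht, hte⟩
      obtain ⟨m, rfl⟩ := coe_eq_coe_iff_exists_int.1 hte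
      have em : orb E (q f (n + 2)) (-p₂) x + m = orb E (q f (n + 2)) (-p₂ + m) x := by
        simp only [orb]; push_cast; ring
      rw [em] at ht
      have k1 : 0 < m := by
        by_contra! hm
        have hm' : (m : ℝ) ≤ 0 := by exact_mod_cast hm
        have : orb E (q f (n + 2)) (-p₂ + m) x < x := horb' (by push_cast; linarith)
        linarith [ht.1]
      have k2 : m < 1 := by
        by_contra! hm
        have hm' : (1 : ℝ) ≤ m := by exact_mod_cast hm
        have : orb E (q f n) (-p + 1) x < orb E (q f (n + 2)) (-p₂ + m) x :=
          hE.orb_lt_orb (by push_cast; linarith) x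
        linarith [ht.2]
      omega
  · have hn1 : signedDist ρ (n + 1) < 0 := neg_of_mul_neg_right hneg hn.le
    have hn2 : 0 < signedDist ρ (n + 2) := by
      by_contra! h
      exact absurd (mul_nonneg_of_nonpos_of_nonpos hn1.le h) (not_le.2 hneg')
    rw [abs_of_pos hn2, abs_of_pos hn] at hlt2
    rw [abs_of_pos hn] at hlt1
    have o1 : x < orb E (q f n) (-p) x := horb (by push_cast; linarith)
    have o2 : orb E (q f n) (-p) x < x + 1 := by
      have : orb E (q f n) (-p) x < orb E 0 1 x := hE.orb_lt_orb (by push_cast; linarith) x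
      simpa [orb] using this
    rw [IsLift.iterate_coe hL (q f n) (-p),
      IsLift.iterate_coe hL (q f (n + 2)) (-p₂), cIcc_coe o1 o2, Set.uIcc_of_le o1.le,
      if_pos]
    exact ⟨_, ⟨(horb (by push_cast; linarith)).le,
      (hE.orb_lt_orb (by push_cast; linarith) x).le⟩, rfl⟩

theorem abs_orb_sub_lt_one {E : ℝ ≃o ℝ} {ρ : ℝ} (hE : IsRotationLike E ρ) (h0 : 0 < ρ) (h1 : ρ < 1)
    (n : ℕ) (x : ℝ) : |orb E (returnTime ρ n) (-numerator ρ n) x - x| < 1 := by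
  have h := abs_lt.1 (signedDist_mul_succ_neg hE.irrational h0 h1 n).2.2.2
  have e : returnTime ρ n * ρ - numerator ρ n = signedDist ρ n := rfl
  have o1 : orb E (returnTime ρ n) (-numerator ρ n) x < orb E 0 1 x :=
    hE.orb_lt_orb (by push_cast; linarith) x
  have o2 : orb E 0 (-1) x < orb E (returnTime ρ n) (-numerator ρ n) x :=
    hE.orb_lt_orb (by push_cast; linarith) x
  simp only [orb, zpow_zero, Int.cast_one, Int.cast_neg] at o1 o2
  change _ < x + 1 at o1
  change x + -1 < _ at o2
  simp only [orb, Int.cast_neg]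
  exact abs_lt.2 ⟨by linarith, by linarith⟩

end MulticriticalCircle

/-! ### Transfer of the bounds from the lift to arcs of the circle -/

theorem mainTheorem7
    (f : MulticriticalCircle.Circle1 ≃ₜ MulticriticalCircle.Circle1)
    (hf : MulticriticalCircle.IsMulticritical f)
    (hper : Function.periodicPts f = ∅) :
    ∃ K : ℝ, 1 < K ∧
      ∀ c₀ : MulticriticalCircle.Circle1, MulticriticalCircle.IsCriticalPt f c₀ →
      ∀ n k : ℕ, k < MulticriticalCircle.a f (n + 1) →
        (∃ y ∈ MulticriticalCircle.Δ f n c₀ k,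
          MulticriticalCircle.IsCriticalPt (f^[MulticriticalCircle.q f (n + 1)]) y) →
        K⁻¹ * MulticriticalCircle.arcLength (MulticriticalCircle.I f n c₀)
            ≤ MulticriticalCircle.arcLength (MulticriticalCircle.Δ f n c₀ k) ∧
          MulticriticalCircle.arcLength (MulticriticalCircle.Δ f n c₀ k)
            ≤ K * MulticriticalCircle.arcLength (MulticriticalCircle.I f n c₀) := by
  open MulticriticalCircle in
  obtain ⟨E, G, hEG, hL, hF, hτ⟩ := hf.exists_lift
  have hirr : Irrational (CircleDeg1Lift.translationNumber G) :=
    irrational_translationNumber (hEG ▸ hL) hper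
  have hE := isRotationLike_of_lift hEG hirr
  rw [hτ] at hE hirr
  have hfr : ∃ t : ℝ, rotationNumber f = Int.fract t :=
    ⟨_, rotationNumber_eq f G (hEG ▸ hL)⟩
  obtain ⟨t, ht⟩ := hfr
  have h0 : 0 < rotationNumber f :=
    lt_of_le_of_ne (ht ▸ Int.fract_nonneg t) hirr.ne_zero.symm
  have h1 : rotationNumber f < 1 := ht ▸ Int.fract_lt_one t
  obtain ⟨K, hK, hb⟩ := hF.exists_abs_le_of_critical_mem hE h0 h1
  refine ⟨K + 1, by linarith, ?_⟩
  rintro c₀ - n k hk ⟨y, hy, hcy⟩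
  obtain ⟨c, rfl⟩ := QuotientAddGroup.mk_surjective c₀
  set ρ := rotationNumber f with hρ
  obtain ⟨A, hA⟩ : ∃ A, A = orb E (returnTime ρ n + (k + 1) * returnTime ρ (n + 1))
    (-(numerator ρ n + (k + 1) * numerator ρ (n + 1))) c := ⟨_, rfl⟩
  obtain ⟨D, hD⟩ : ∃ D, D = orb E (returnTime ρ n + k * returnTime ρ (n + 1))
    (-(numerator ρ n + k * numerator ρ (n + 1))) c := ⟨_, rfl⟩
  have hΔ : Δ f n (c : Circle1) k = (fun x : ℝ => (x : Circle1)) '' Set.uIcc A D := by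
    unfold Δ
    rw [I_coe hL hE h0 h1, Set.image_image]
    simp only [IsLift.iterate_coe hL _ (-(numerator ρ n + k * numerator ρ (n + 1)))]
    rw [← Set.image_image (fun x : ℝ => (x : Circle1)) (orb E _ _), orb_image_uIcc, hE.orb_orb,
      Set.uIcc_comm]
    congr 2
    · rw [hA]; congr 1
      · simp only [q]; push_cast; ring
      · ring
    · rw [hD]; simp only [q]; push_cast; rfl
  have hI : arcLength (I f n (c : Circle1)) =
      |orb E (returnTime ρ n) (-numerator ρ n) c - c| := by
    rw [I_coe hL hE h0 h1]
    exact arcLength_image_uIcc (abs_orb_sub_lt_one hE h0 h1 n c)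
  -- Only the containment part is used here, so the point of the arc is the dummy value 0. It gives
  -- the upper bound, and shows that the lifted Δ_k has length below 1 and projects with its length
  -- preserved.
  have hle := (hb n k hk c 0 A D hA hD).1
  have hΔ' : arcLength (Δ f n (c : Circle1) k) = |D - A| := by
    rw [hΔ]
    exact arcLength_image_uIcc (hle.trans_lt (abs_orb_sub_lt_one hE h0 h1 n c))
  rw [hΔ] at hy
  obtain ⟨y₀, hy₀, rfl⟩ := hy
  have hmain := (hb n k hk c y₀ A D hA hD).2 hy₀ (hF.exists_of_isCriticalPt_iterate hL hcy)
  change _ * arcLength (I f n (c : Circle1)) ≤ arcLength (Δ f n (c : Circle1) k) ∧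
    arcLength (Δ f n (c : Circle1) k) ≤ _ * arcLength (I f n (c : Circle1))
  rw [hI, hΔ']
  constructor
  · rw [inv_mul_le_iff₀ (by linarith)]
    have := abs_nonneg (D - A)
    linarith
  · have h2 := abs_nonneg (orb E (returnTime ρ n) (-numerator ρ n) c - c)
    have h3 : 0 ≤ K * |orb E (returnTime ρ n) (-numerator ρ n) c - c| := by positivity
    linarith
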